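/- Let $d\in\mathbb N$, $\lambda>0$, $\alpha,\beta\ge 0$, and let $\pi=e^{-V}\,dx$ be a probability measure on $\mathbb R^d$ such that $V\in C^2(\mathbb R^d)$ is $\lambda$-convex, i.e. $x\mapsto V(x)-\frac{\lambda}{2}|x|^2$ is convex, and such that $V$, $\nabla V$ and $\nabla^2V$ are integrable with respect to every non-degenerate Gaussian measure. Let $\mathfrak P_1$ be the set of pairs $\mathsf p=(\Sigma,m)$ with $\Sigma\in\mathbb R^{d\times d}$ symmetric positive definite and $m\in\mathbb R^d$, let $\mathsf G(\mathsf p)$ be the Gaussian probability measure with covariance $\Sigma$ and mean $m$, and let $$\mathsf E_1(\mathsf p)=\mathcal H_B(\mathsf G(\mathsf p)\,|\,\pi)\in[0,\infty],\qquad \mathcal H_B(\rho|\pi)=\int \Big(\tfrac{d\rho}{d\pi}\log\tfrac{d\rho}{d\pi}-\tfrac{d\rho}{d\pi}+1\Big)\,d\pi ,$$ be the relative entropy with respect to $\pi$. Let $J\subseteq[0,\infty)$ be an interval containing $0$ (for instance $J=[0,\infty)$), and consider solutions $\mathsf p=(\Sigma,m):J\to\mathfrak P_1$ of the gradient-flow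 equation $\dot{\mathsf p}=-\mathbb K^{\rm red}_{\alpha,\beta}(\mathsf p)\,D\mathsf E_1(\mathsf p)$, where $$D\mathsf E_1(\mathsf p)=\Big(\tfrac12\Big(\int\nabla^2V\,d\mathsf G(\mathsf p)-\Sigma^{-1}\Big),\ \int\nabla V\,d\mathsf G(\mathsf p)\Big),$$ $$\mathbb K^{\rm red}_{\alpha,\beta}(\mathsf p)(S,\mu)=\big(2\alpha(S\Sigma+\Sigma S)+2\beta\,\Sigma S\Sigma,\ (\alpha I+\beta\Sigma)\mu\big).$$ Explicitly, with $A=\int\nabla^2V\,d\mathsf G(\mathsf p)$, $$\dot\Sigma=\alpha(2I-A\Sigma-\Sigma A)+\beta(\Sigma-\Sigma A\Sigma),\qquad \dot m=-(\alpha I+\beta\Sigma)\int\nabla V\,d\mathsf G(\mathsf p).$$ (i) For every finite $E\ge 0$ there is $r_E>0$ such that every $\mathsf p=(\Sigma,m)\in\mathfrak P_1$ with $\mathsf E_1(\mathsf p)\le E$ satisfies $|m|\le r_E$ and $r_E^{-1}\le\sigma\le r_E$ for every eigenvalue $\sigma$ of $\Sigma$. (ii) Let $E\in[0,\infty]$,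 let $r_E>0$ be any constant with the property in (i) for this $E$, and set $\gamma=\lambda(2\alpha+\beta r_E^{-1})$. Then every solution $\mathsf p$ on $J$ with $\mathsf E_1(\mathsf p(0))\le E$ satisfies, for all $t\in J$, $$\mathsf E_1(\mathsf p(t))\le e^{-\gamma t}\,\mathsf E_1(\mathsf p(0))+(1-e^{-\gamma t})\inf_{\mathsf q\in\mathfrak P_1}\mathsf E_1(\mathsf q).$$ -/

import Mathlib

open MeasureTheory

namespace GaussHK

/-- The parameter space of normalized Gaussians: symmetric positive definite covariance matrices
together with means. (`Matrix.PosDef` includes symmetry.) -/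
structure Param (d : ℕ) where
  cov : Matrix (Fin d) (Fin d) ℝ
  mean : EuclideanSpace ℝ (Fin d)
  posDef : cov.PosDef

/-- The action of a matrix on a Euclidean vector. -/
noncomputable def act {d : ℕ} (A : Matrix (Fin d) (Fin d) ℝ) (v : EuclideanSpace ℝ (Fin d)) :
    EuclideanSpace ℝ (Fin d) :=
  WithLp.toLp 2 (A.mulVec v.ofLp)

/-- The density `exp (-(x - m) · Σ⁻¹ (x - m) / 2) / √(det (2 π Σ))`. -/
noncomputable def gaussDensity {d : ℕ} (p : Param d) (x : EuclideanSpace ℝ (Fin d)) : ℝ :=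
  Real.exp (-(1 / 2) * inner ℝ (x - p.mean) (act p.cov⁻¹ (x - p.mean))) /
    Real.sqrt ((2 * Real.pi) • p.cov).det

/-- The normalized Gaussian measure with parameter `p = (Σ, m)`. -/
noncomputable def gauss {d : ℕ} (p : Param d) : Measure (EuclideanSpace ℝ (Fin d)) :=
  volume.withDensity (fun x => ENNReal.ofReal (gaussDensity p x))

/-- The target measure `e^{-V} dx`. -/
noncomputable def target {d : ℕ} (V : EuclideanSpace ℝ (Fin d) → ℝ) :
    Measure (EuclideanSpace ℝ (Fin d)) :=
  volume.withDensity (fun x => ENNReal.ofReal (Real.exp (-V x)))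

/-- The driving energy: the Boltzmann (relative) entropy of the Gaussian with parameter `p` with
respect to the target `e^{-V} dx`, with values in `[0, ∞]`. -/
noncomputable def energy {d : ℕ} (V : EuclideanSpace ℝ (Fin d) → ℝ) (p : Param d) : ENNReal :=
  InformationTheory.klDiv (gauss p) (target V)

/-- The Hessian matrix of `V` at `x`. -/
noncomputable def hess {d : ℕ} (V : EuclideanSpace ℝ (Fin d) → ℝ)
    (x : EuclideanSpace ℝ (Fin d)) : Matrix (Fin d) (Fin d) ℝ :=
  Matrix.of fun i j =>
    fderiv ℝ (fderiv ℝ V) x (EuclideanSpace.single i 1) (EuclideanSpace.single j 1)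

/-- The Gaussian average of the gradient of `V`. -/
noncomputable def meanGrad {d : ℕ} (V : EuclideanSpace ℝ (Fin d) → ℝ) (p : Param d) :
    EuclideanSpace ℝ (Fin d) :=
  ∫ x, gradient V x ∂(gauss p)

/-- The Gaussian average of the Hessian of `V`, entry by entry. -/
noncomputable def meanHess {d : ℕ} (V : EuclideanSpace ℝ (Fin d) → ℝ) (p : Param d) :
    Matrix (Fin d) (Fin d) ℝ :=
  Matrix.of fun i j => ∫ x, hess V x i j ∂(gauss p)

/-- The differential of the driving energy with respect to `(Σ, m)`:
`D_Σ E = (∫ ∇²V dG - Σ⁻¹) / 2` and `D_m E = ∫ ∇V dG`. -/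
noncomputable def dEnergy {d : ℕ} (V : EuclideanSpace ℝ (Fin d) → ℝ) (p : Param d) :
    Matrix (Fin d) (Fin d) ℝ × EuclideanSpace ℝ (Fin d) :=
  ((1 / 2 : ℝ) • (meanHess V p - p.cov⁻¹), meanGrad V p)

/-- The reduced Onsager operator `α K_Otto + β K_SHe` at `p`, applied to `η = (S, μ)`:
`(2 α (S Σ + Σ S) + 2 β Σ S Σ, α μ + β Σ μ)`. -/
noncomputable def onsager {d : ℕ} (α β : ℝ) (p : Param d)
    (η : Matrix (Fin d) (Fin d) ℝ × EuclideanSpace ℝ (Fin d)) :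
    Matrix (Fin d) (Fin d) ℝ × EuclideanSpace ℝ (Fin d) :=
  (α • ((2 : ℝ) • (η.1 * p.cov + p.cov * η.1)) + β • ((2 : ℝ) • (p.cov * η.1 * p.cov)),
    α • η.2 + β • act p.cov η.2)

/-- `p` solves the gradient-flow equation `p' = - K(p) DE(p)` on `J`; the equation for the
covariance matrix is read entry by entry. -/
def IsGradientFlow {d : ℕ} (V : EuclideanSpace ℝ (Fin d) → ℝ) (α β : ℝ) (J : Set ℝ)
    (p : ℝ → Param d) : Prop :=
  ∀ t ∈ J,
    (∀ i j, HasDerivWithinAt (fun s => (p s).cov i j)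
      (-(onsager α β (p t) (dEnergy V (p t))).1 i j) J t) ∧
    HasDerivWithinAt (fun s => (p s).mean) (-(onsager α β (p t) (dEnergy V (p t))).2) J t

/-- `r` bounds the sublevel `{E₁ ≤ E}`: there, all eigenvalues of the covariance lie in
`[r⁻¹, r]` and the mean has norm at most `r`. -/
def SublevelBound {d : ℕ} (V : EuclideanSpace ℝ (Fin d) → ℝ) (E : ENNReal) (r : ℝ) : Prop :=
  ∀ p : Param d, energy V p ≤ E →
    (∀ i, r⁻¹ ≤ p.posDef.isHermitian.eigenvalues i ∧ p.posDef.isHermitian.eigenvalues i ≤ r) ∧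
    ‖p.mean‖ ≤ r

/-- The decay rate `γ = λ (2 α + β / r)`. -/
noncomputable def rate (lam α β r : ℝ) : ℝ := lam * (2 * α + β * r⁻¹)

end GaussHK

/-!
The energy of a Gaussian is `E(p) = ∫ V dG(p) - d / 2 - log Z(p)`, where `Z(p) = √(det (2 π Σ))`
(`energy_eq_ofReal_realEnergy`), so the whole statement concerns a real-valued function.

*Sublevels.* By `lam`-convexity `V` grows at least like `lam / 4 * ‖x‖ ^ 2`. Hence `E(p)` dominates,
up to a constant, `lam / 4 * ‖m‖ ^ 2 + ∑ (lam / 4 * σ - log σ / 2)`, the sum running over the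
eigenvalues `σ` of `Σ` (`exists_le_realEnergy`). Each summand is bounded below and blows up as
`σ → 0` or `σ → ∞`, so that bounded energy bounds every summand (`exists_sublevelBound`).

*Gradient domination.* Any two Gaussians are related by an affine map `x ↦ m₁ + A (x - m₀)` with `A`
symmetric positive definite. Integrating the tangent plane inequality for `V` along this map, with
Stein's identity for the first-order term and `log (det A) ≤ tr A - d` for the entropy, gives
displacement convexity (`realEnergy_add_le`). Completing squares turns it into
`2 lam (E(p) - E(q)) ≤ 4 tr (S Σ S) + ‖μ‖ ^ 2` for all `q`, where `(S, μ) = DE(p)`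
(`two_mul_sub_le_ottoDissipation`). The right-hand side is the dissipation of the Otto part of the
Onsager operator. When the eigenvalues of `Σ` are at least `r⁻¹`, the spherical Hellinger part
dissipates at least `r⁻¹ / 2` times as much (`mul_ottoDissipation_le_dissipation`).

*Decay.* Gaussian averages are differentiated in the natural parameters of the exponential family,
where domination only involves the density and hence needs no control of `V` beyond Gaussian
integrability (`hasFDerivAt_integral_exp_neg`). Two integrations by parts identify the derivative
with `DE` (`hasDerivWithinAt_realEnergy`). Along the flow the energy decreases, so the flow stays in
its initial sublevel, the eigenvalue bound is available at all times, and Gronwall's inequality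
applies against every competitor `q`.
-/

namespace GaussHK

variable {d : ℕ}

/-! ### The action of matrices on Euclidean vectors -/

theorem act_eq_toEuclideanCLM (A : Matrix (Fin d) (Fin d) ℝ) (v : EuclideanSpace ℝ (Fin d)) :
    act A v = Matrix.toEuclideanCLM (𝕜 := ℝ) A v := rfl

theorem act_apply (A : Matrix (Fin d) (Fin d) ℝ) (v : EuclideanSpace ℝ (Fin d)) (i : Fin d) :
    act A v i = ∑ j, A i j * v j := rfl

@[simp] theorem act_one (v : EuclideanSpace ℝ (Fin d)) : act 1 v = v := by
  simp [act_eq_toEuclideanCLM]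

theorem act_mul (A B : Matrix (Fin d) (Fin d) ℝ) (v : EuclideanSpace ℝ (Fin d)) :
    act (A * B) v = act A (act B v) := by
  simp [act_eq_toEuclideanCLM]

theorem act_sub (A : Matrix (Fin d) (Fin d) ℝ) (v w : EuclideanSpace ℝ (Fin d)) :
    act A (v - w) = act A v - act A w := by
  simp [act_eq_toEuclideanCLM]

theorem add_act (A B : Matrix (Fin d) (Fin d) ℝ) (v : EuclideanSpace ℝ (Fin d)) :
    act (A + B) v = act A v + act B v := by
  simp [act_eq_toEuclideanCLM]

theorem sub_act (A B : Matrix (Fin d) (Fin d) ℝ) (v : EuclideanSpace ℝ (Fin d)) :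
    act (A - B) v = act A v - act B v := by
  simp [act_eq_toEuclideanCLM]

theorem smul_act (c : ℝ) (A : Matrix (Fin d) (Fin d) ℝ) (v : EuclideanSpace ℝ (Fin d)) :
    act (c • A) v = c • act A v := by
  simp [act_eq_toEuclideanCLM]

theorem inner_act_left (A : Matrix (Fin d) (Fin d) ℝ) (v w : EuclideanSpace ℝ (Fin d)) :
    inner ℝ (act A v) w = inner ℝ v (act A.transpose w) := by
  simp only [PiLp.inner_apply, act_apply, Finset.sum_mul, RCLike.inner_apply, conj_trivial,
    Finset.mul_sum, Matrix.transpose_apply]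
  rw [Finset.sum_comm]
  exact Finset.sum_congr rfl fun i _ => Finset.sum_congr rfl fun j _ => by ring

theorem inner_single_act_single (A : Matrix (Fin d) (Fin d) ℝ) (i j : Fin d) :
    inner ℝ (EuclideanSpace.single i (1 : ℝ)) (act A (EuclideanSpace.single j 1)) = A i j := by
  simp [EuclideanSpace.inner_single_left, act_apply]

open scoped Matrix.Norms.L2Operator in
theorem norm_act_le (A : Matrix (Fin d) (Fin d) ℝ) (v : EuclideanSpace ℝ (Fin d)) :
    ‖act A v‖ ≤ ‖A‖ * ‖v‖ :=
  Matrix.l2_opNorm_mulVec A v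

open scoped MatrixOrder in
theorem exists_eq_transpose_mul_self {P : Matrix (Fin d) (Fin d) ℝ} (hP : P.PosDef) :
    ∃ B : Matrix (Fin d) (Fin d) ℝ, IsUnit B ∧ P = B.transpose * B := by
  have h := CStarAlgebra.isStrictlyPositive_iff_eq_star_mul_self.1 hP.isStrictlyPositive
  simpa [Matrix.star_eq_conjTranspose] using h

/-- A positive definite form is bounded below by a multiple of the squared norm. -/
theorem exists_le_inner_act {P : Matrix (Fin d) (Fin d) ℝ} (hP : P.PosDef) :
    ∃ c : ℝ, 0 < c ∧ ∀ x : EuclideanSpace ℝ (Fin d), c * ‖x‖ ^ 2 ≤ inner ℝ x (act P x) := by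
  obtain ⟨B, hB, rfl⟩ := exists_eq_transpose_mul_self hP
  have hB' : B⁻¹ * B = 1 := Matrix.nonsing_inv_mul _ ((Matrix.isUnit_iff_isUnit_det _).1 hB)
  open scoped Matrix.Norms.L2Operator in
  refine ⟨((‖B⁻¹‖ + 1) ^ 2)⁻¹, by positivity, fun x => ?_⟩
  rw [act_mul, ← inner_act_left, real_inner_self_eq_norm_sq]
  have h1 : ‖x‖ ≤ (‖B⁻¹‖ + 1) * ‖act B x‖ := by
    calc ‖x‖ = ‖act B⁻¹ (act B x)‖ := by rw [← act_mul, hB', act_one]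
      _ ≤ ‖B⁻¹‖ * ‖act B x‖ := norm_act_le _ _
      _ ≤ _ := by gcongr; linarith
  rw [inv_mul_le_iff₀ (by positivity), ← mul_pow]
  gcongr

/-! ### Functions integrable against all Gaussians -/

/-- `f` is integrable against every centred isotropic Gaussian weight `exp (-c ‖x‖ ^ 2)`, `c > 0`.
By domination this is the same as integrability against every non-degenerate Gaussian measure. -/
def GaussIntegrable {F : Type*} [NormedAddCommGroup F] [NormedSpace ℝ F]
    (f : EuclideanSpace ℝ (Fin d) → F) : Prop :=
  ∀ c : ℝ, 0 < c → Integrable fun x => Real.exp (-c * ‖x‖ ^ 2) • f x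

section
variable {F : Type*} [NormedAddCommGroup F] [NormedSpace ℝ F] {f : EuclideanSpace ℝ (Fin d) → F}

theorem gaussIntegrable_const (a : F) :
    GaussIntegrable fun _ : EuclideanSpace ℝ (Fin d) => a := by
  intro c hc
  refine Integrable.smul_const ?_ a
  have h := (GaussianFourier.integrable_cexp_neg_mul_sq_norm_add (b := (c : ℂ))
    (V := EuclideanSpace ℝ (Fin d)) (by simpa using hc) 0 0).norm
  refine h.congr (Filter.Eventually.of_forall fun x => ?_)
  simp [Complex.norm_exp, ← Complex.ofReal_pow]

theorem GaussIntegrable.aestronglyMeasurable (hf : GaussIntegrable f) :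
    AEStronglyMeasurable f volume := by
  have h := (hf 1 one_pos).aestronglyMeasurable
  have h2 : AEStronglyMeasurable
      (fun x : EuclideanSpace ℝ (Fin d) => Real.exp (1 * ‖x‖ ^ 2)) volume := by fun_prop
  refine (h2.smul h).congr (Filter.Eventually.of_forall fun x => ?_)
  simp [smul_smul, ← Real.exp_add]

/-- Polynomial factors do not matter: the weight `exp (-c ‖x‖ ^ 2)` can be split in two halves, of
which one absorbs the factor. -/
theorem one_add_sq_mul_exp_le {c : ℝ} (hc : 0 < c) (r : ℝ) :
    (1 + r ^ 2) * Real.exp (-c * r ^ 2) ≤ (1 + 2 / c) * Real.exp (-(c / 2) * r ^ 2) := by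
  have h1 : Real.exp (-c * r ^ 2) = Real.exp (-(c / 2) * r ^ 2) * Real.exp (-(c / 2) * r ^ 2) := by
    rw [← Real.exp_add]; ring_nf
  have h2 := Real.add_one_le_exp (c / 2 * r ^ 2)
  have h3 : Real.exp (-(c / 2) * r ^ 2) * Real.exp (c / 2 * r ^ 2) = 1 := by
    rw [← Real.exp_add]; simp
  have h4 : Real.exp (-(c / 2) * r ^ 2) ≤ 1 := Real.exp_le_one_iff.2 (by
    have : 0 ≤ c / 2 * r ^ 2 := by positivity
    linarith)
  have hp := Real.exp_pos (-(c / 2) * r ^ 2)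
  rw [h1, ← mul_assoc]
  gcongr
  have h5 : c / 2 * r ^ 2 * Real.exp (-(c / 2) * r ^ 2) ≤ 1 := by nlinarith
  have h6 : r ^ 2 * Real.exp (-(c / 2) * r ^ 2) ≤ 2 / c := by
    rw [le_div_iff₀ hc]; linarith
  linarith

theorem GaussIntegrable.of_norm_le {G : Type*} [NormedAddCommGroup G] [NormedSpace ℝ G]
    {g : EuclideanSpace ℝ (Fin d) → G} (hf : GaussIntegrable f)
    (hg : AEStronglyMeasurable g volume) (C : ℝ)
    (h : ∀ x, ‖g x‖ ≤ C * (1 + ‖x‖ ^ 2) * ‖f x‖) : GaussIntegrable g := by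
  intro c hc
  refine (((hf (c / 2) (by positivity)).norm).const_mul (|C| * (1 + 2 / c))).mono'
    (AEStronglyMeasurable.smul (by fun_prop) hg) (Filter.Eventually.of_forall fun x => ?_)
  rw [norm_smul, norm_smul, Real.norm_of_nonneg (Real.exp_pos _).le,
    Real.norm_of_nonneg (Real.exp_pos _).le]
  have h1 : C * (1 + ‖x‖ ^ 2) * ‖f x‖ ≤ |C| * (1 + ‖x‖ ^ 2) * ‖f x‖ := by
    gcongr; exact le_abs_self C
  calc Real.exp (-c * ‖x‖ ^ 2) * ‖g x‖
      ≤ Real.exp (-c * ‖x‖ ^ 2) * (|C| * (1 + ‖x‖ ^ 2) * ‖f x‖) := by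
        gcongr; exact (h x).trans h1
    _ = |C| * ((1 + ‖x‖ ^ 2) * Real.exp (-c * ‖x‖ ^ 2)) * ‖f x‖ := by ring
    _ ≤ |C| * ((1 + 2 / c) * Real.exp (-(c / 2) * ‖x‖ ^ 2)) * ‖f x‖ := by
        gcongr ?_ * ?_ * ?_; exact one_add_sq_mul_exp_le hc _
    _ = _ := by ring

theorem GaussIntegrable.add {g : EuclideanSpace ℝ (Fin d) → F} (hf : GaussIntegrable f)
    (hg : GaussIntegrable g) : GaussIntegrable fun x => f x + g x := fun c hc => by
  simpa only [smul_add] using! (hf c hc).add (hg c hc)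

/-- Multiplication by an affine function preserves Gaussian integrability. -/
theorem GaussIntegrable.mul_inner {f : EuclideanSpace ℝ (Fin d) → ℝ} (hf : GaussIntegrable f)
    (m u : EuclideanSpace ℝ (Fin d)) : GaussIntegrable fun x => f x * inner ℝ (x - m) u := by
  refine hf.of_norm_le (hf.aestronglyMeasurable.mul (by fun_prop)) ((1 + ‖m‖) * ‖u‖) fun x => ?_
  rw [norm_mul, mul_comm ‖f x‖]
  gcongr
  have h1 : ‖x - m‖ ≤ (1 + ‖m‖) * (1 + ‖x‖ ^ 2) := by
    have := norm_sub_le x m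
    have := norm_nonneg m
    nlinarith [sq_nonneg (‖x‖ - 1), mul_nonneg this (sq_nonneg ‖x‖)]
  calc ‖inner ℝ (x - m) u‖ ≤ ‖x - m‖ * ‖u‖ := norm_inner_le_norm _ _
    _ ≤ (1 + ‖m‖) * (1 + ‖x‖ ^ 2) * ‖u‖ := by gcongr
    _ = _ := by ring

end

/-! ### The Gaussian densities -/

/-- The normalizing constant `√(det (2 π Σ))`. -/
noncomputable def partition (p : Param d) : ℝ := Real.sqrt ((2 * Real.pi) • p.cov).det

/-- The exponent `(x - m) · Σ⁻¹ (x - m) / 2`. -/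
noncomputable def quad (p : Param d) (x : EuclideanSpace ℝ (Fin d)) : ℝ :=
  1 / 2 * inner ℝ (x - p.mean) (act p.cov⁻¹ (x - p.mean))

theorem Param.det_ne_zero (p : Param d) : p.cov.det ≠ 0 := p.posDef.det_pos.ne'

theorem Param.cov_mul_inv (p : Param d) : p.cov * p.cov⁻¹ = 1 :=
  Matrix.mul_nonsing_inv _ p.det_ne_zero.isUnit

theorem Param.inv_mul_cov (p : Param d) : p.cov⁻¹ * p.cov = 1 :=
  Matrix.nonsing_inv_mul _ p.det_ne_zero.isUnit

theorem Param.transpose_cov (p : Param d) : p.cov.transpose = p.cov := by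
  simpa using p.posDef.isHermitian.eq

theorem Param.transpose_inv (p : Param d) : p.cov⁻¹.transpose = p.cov⁻¹ := by
  rw [Matrix.transpose_nonsing_inv, p.transpose_cov]

theorem partition_pos (p : Param d) : 0 < partition p := by
  rw [partition, Matrix.det_smul]
  have := p.posDef.det_pos
  positivity

theorem gaussDensity_eq (p : Param d) (x : EuclideanSpace ℝ (Fin d)) :
    gaussDensity p x = Real.exp (-quad p x) / partition p := by
  rw [gaussDensity, quad, partition, neg_mul]

theorem gaussDensity_pos (p : Param d) (x : EuclideanSpace ℝ (Fin d)) : 0 < gaussDensity p x := by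
  rw [gaussDensity_eq]
  exact div_pos (Real.exp_pos _) (partition_pos p)

theorem contDiff_quad (p : Param d) : ContDiff ℝ ⊤ (quad p) := by
  unfold quad
  simp only [act_eq_toEuclideanCLM]
  exact contDiff_const.mul (ContDiff.inner ℝ (by fun_prop) (by fun_prop))

theorem continuous_gaussDensity (p : Param d) : Continuous (gaussDensity p) := by
  have := (contDiff_quad p).continuous
  simp only [funext (gaussDensity_eq p)]
  fun_prop

/-- The exponent of a Gaussian is bounded below by that of a centred isotropic one. -/
theorem exists_le_quad (p : Param d) :
    ∃ c C : ℝ, 0 < c ∧ ∀ x, c * ‖x‖ ^ 2 - C ≤ quad p x := by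
  obtain ⟨c, hc, h⟩ := exists_le_inner_act p.posDef.inv
  refine ⟨c / 4, c / 2 * ‖p.mean‖ ^ 2, by positivity, fun x => ?_⟩
  have h1 := h (x - p.mean)
  have h2 : ‖x‖ ^ 2 ≤ 2 * ‖x - p.mean‖ ^ 2 + 2 * ‖p.mean‖ ^ 2 := by
    have h3 : ‖x‖ ≤ ‖x - p.mean‖ + ‖p.mean‖ := by
      simpa using norm_add_le (x - p.mean) p.mean
    nlinarith [norm_nonneg x, sq_nonneg (‖x - p.mean‖ - ‖p.mean‖)]
  rw [quad]
  nlinarith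

theorem integral_gauss {F : Type*} [NormedAddCommGroup F] [NormedSpace ℝ F] (p : Param d)
    (f : EuclideanSpace ℝ (Fin d) → F) :
    ∫ x, f x ∂(gauss p) = ∫ x, gaussDensity p x • f x := by
  rw [gauss, integral_withDensity_eq_integral_toReal_smul
    (by have := continuous_gaussDensity p; fun_prop) (by simp)]
  simp [ENNReal.toReal_ofReal (gaussDensity_pos p _).le]

theorem integrable_gauss_iff {F : Type*} [NormedAddCommGroup F] [NormedSpace ℝ F] (p : Param d)
    (f : EuclideanSpace ℝ (Fin d) → F) :
    Integrable f (gauss p) ↔ Integrable fun x => gaussDensity p x • f x := by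
  rw [gauss, integrable_withDensity_iff_integrable_smul'
    (by have := continuous_gaussDensity p; fun_prop) (by simp)]
  simp [ENNReal.toReal_ofReal (gaussDensity_pos p _).le]

section
variable {F : Type*} [NormedAddCommGroup F] [NormedSpace ℝ F] {f : EuclideanSpace ℝ (Fin d) → F}

theorem GaussIntegrable.integrable_exp_smul (hf : GaussIntegrable f)
    {φ : EuclideanSpace ℝ (Fin d) → ℝ} (hφ : Continuous φ) {c C : ℝ} (hc : 0 < c)
    (h : ∀ x, c * ‖x‖ ^ 2 - C ≤ φ x) : Integrable fun x => Real.exp (-φ x) • f x := by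
  refine ((hf c hc).norm.const_mul (Real.exp C)).mono'
    (AEStronglyMeasurable.smul (by fun_prop) hf.aestronglyMeasurable)
    (Filter.Eventually.of_forall fun x => ?_)
  rw [norm_smul, norm_smul, Real.norm_of_nonneg (Real.exp_pos _).le,
    Real.norm_of_nonneg (Real.exp_pos _).le, ← mul_assoc, ← Real.exp_add]
  gcongr
  linarith [h x]

theorem GaussIntegrable.integrable_gauss (hf : GaussIntegrable f) (p : Param d) :
    Integrable f (gauss p) := by
  obtain ⟨c, C, hc, h⟩ := exists_le_quad p
  rw [integrable_gauss_iff]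
  refine ((hf.integrable_exp_smul (contDiff_quad p).continuous hc h).smul (partition p)⁻¹).congr
    (Filter.Eventually.of_forall fun x => ?_)
  simp only [Pi.smul_apply, smul_smul, gaussDensity_eq]
  ring_nf

theorem GaussIntegrable.of_gauss (hf : ∀ p : Param d, Integrable f (gauss p)) :
    GaussIntegrable f := by
  intro c hc
  have hpd : ((1 / (2 * c)) • (1 : Matrix (Fin d) (Fin d) ℝ)).PosDef :=
    Matrix.PosDef.one.smul (by positivity)
  let p : Param d := ⟨(1 / (2 * c)) • 1, 0, hpd⟩
  have h := (integrable_gauss_iff p f).1 (hf p)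
  refine (h.smul (partition p)).congr (Filter.Eventually.of_forall fun x => ?_)
  have hinv : p.cov⁻¹ = (2 * c) • (1 : Matrix (Fin d) (Fin d) ℝ) := by
    refine Matrix.inv_eq_left_inv ?_
    simp only [p, smul_mul_smul_comm, mul_one]
    rw [mul_one_div_cancel (by positivity), one_smul]
  have hq : quad p x = c * ‖x‖ ^ 2 := by
    rw [quad, hinv, smul_act, act_one, inner_smul_right, real_inner_self_eq_norm_sq]
    simp only [p, sub_zero]
    ring
  simp only [Pi.smul_apply, smul_smul, gaussDensity_eq, hq]
  rw [mul_div_cancel₀ _ (partition_pos p).ne', neg_mul]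

end

/-! ### Affine images and normalization -/

theorem partition_eq_abs_det_mul (p q : Param d) {A : Matrix (Fin d) (Fin d) ℝ}
    (h : A * p.cov * A.transpose = q.cov) : partition q = |A.det| * partition p := by
  rw [partition, partition, ← Real.sqrt_sq_eq_abs, ← Real.sqrt_mul (sq_nonneg _), ← h,
    Matrix.det_smul, Matrix.det_smul, Matrix.det_mul, Matrix.det_mul, Matrix.det_transpose]
  ring_nf

/-- If `A Σ₀ Aᵀ = Σ₁` then the Gaussian with parameter `(Σ₁, m₁)` is the image of the one with
parameter `(Σ₀, m₀)` under `x ↦ m₁ + A (x - m₀)`. -/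
theorem gauss_eq_map_gauss (p q : Param d) {A : Matrix (Fin d) (Fin d) ℝ} (hA : IsUnit A)
    (h : A * p.cov * A.transpose = q.cov) :
    gauss q = (gauss p).map fun x => q.mean + act A (x - p.mean) := by
  have hdet : IsUnit A.det := (Matrix.isUnit_iff_isUnit_det _).1 hA
  have hinv : A⁻¹ * A = 1 := Matrix.nonsing_inv_mul _ hdet
  have hinv' : A * A⁻¹ = 1 := Matrix.mul_nonsing_inv _ hdet
  have hq : A.transpose * q.cov⁻¹ * A = p.cov⁻¹ := by
    rw [← h, Matrix.mul_inv_rev, Matrix.mul_inv_rev]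
    have hT : A.transpose * A.transpose⁻¹ = 1 :=
      Matrix.mul_nonsing_inv _ (by simpa using hdet)
    calc _ = A.transpose * A.transpose⁻¹ * p.cov⁻¹ * (A⁻¹ * A) := by simp only [Matrix.mul_assoc]
      _ = _ := by rw [hT, hinv, Matrix.one_mul, Matrix.mul_one]
  let T : EuclideanSpace ℝ (Fin d) → EuclideanSpace ℝ (Fin d) :=
    fun x => q.mean + act A (x - p.mean)
  have hquad : ∀ x, quad q (T x) = quad p x := fun x => by
    simp only [quad, T, add_sub_cancel_left]
    rw [inner_act_left, ← act_mul, ← act_mul, hq]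
  have hT' : ∀ x, HasFDerivAt T (Matrix.toEuclideanCLM (𝕜 := ℝ) A) x := fun x => by
    have := ((Matrix.toEuclideanCLM (𝕜 := ℝ) A).hasFDerivAt (x := x - p.mean)).comp x
      ((hasFDerivAt_id x).sub_const p.mean)
    exact HasFDerivAt.congr_fderiv (f := T) (this.const_add q.mean) (by ext; simp)
  have hinj : Function.Injective T := fun x y hxy => by
    have h1 : act A (x - p.mean) = act A (y - p.mean) := add_left_cancel hxy
    have h2 := congrArg (act A⁻¹) h1
    simpa [← act_mul, hinv] using h2
  have hsurj : Function.Surjective T := fun y =>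
    ⟨p.mean + act A⁻¹ (y - q.mean), by simp [T, ← act_mul, hinv']⟩
  have hdetA : (Matrix.toEuclideanCLM (𝕜 := ℝ) A).det = A.det := by
    rw [ContinuousLinearMap.det]
    exact LinearMap.det_toLin _ _
  have hTc : Continuous T := continuous_iff_continuousAt.2 fun x => (hT' x).continuousAt
  ext s hs
  have hcv := lintegral_image_eq_lintegral_abs_det_fderiv_mul volume MeasurableSet.univ
    (fun x _ => (hT' x).hasFDerivWithinAt) hinj.injOn
    (s.indicator fun y => ENNReal.ofReal (gaussDensity q y))
  rw [Set.image_univ, hsurj.range_eq, Measure.restrict_univ, hdetA] at hcv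
  rw [Measure.map_apply hTc.measurable hs, gauss, gauss, withDensity_apply _ hs,
    withDensity_apply _ (hTc.measurable hs), ← lintegral_indicator hs,
    ← lintegral_indicator (hTc.measurable hs), hcv]
  refine lintegral_congr fun x => ?_
  by_cases hx : T x ∈ s
  · have hx' : x ∈ T ⁻¹' s := hx
    have hne : |A.det| ≠ 0 := abs_ne_zero.2 hdet.ne_zero
    rw [Set.indicator_of_mem hx, Set.indicator_of_mem hx', ← ENNReal.ofReal_mul (abs_nonneg _),
      gaussDensity_eq, gaussDensity_eq, hquad, partition_eq_abs_det_mul p q h]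
    congr 1
    field_simp
  · have hx' : x ∉ T ⁻¹' s := hx
    rw [Set.indicator_of_notMem hx, Set.indicator_of_notMem hx', mul_zero]

theorem continuous_affine (p q : Param d) (A : Matrix (Fin d) (Fin d) ℝ) :
    Continuous fun x => q.mean + act A (x - p.mean) := by
  simp only [act_eq_toEuclideanCLM]
  fun_prop

/-- The parameter of the standard Gaussian. -/
noncomputable def stdParam : Param d := ⟨1, 0, Matrix.PosDef.one⟩

theorem integral_gaussDensity_stdParam :
    ∫ x, gaussDensity (stdParam : Param d) x = 1 := by
  have h : ∀ x, gaussDensity (stdParam : Param d) x =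
      Real.exp (-(1 / 2) * ‖x‖ ^ 2) / partition (stdParam : Param d) := fun x => by
    rw [gaussDensity_eq, quad]
    simp [stdParam]
  simp_rw [h]
  rw [integral_div, GaussianFourier.integral_rexp_neg_mul_sq_norm (by norm_num),
    div_eq_one_iff_eq (partition_pos _).ne', partition, stdParam, Matrix.det_smul, Matrix.det_one,
    mul_one, Real.sqrt_eq_rpow, ← Real.rpow_natCast, ← Real.rpow_mul (by positivity)]
  simp only [finrank_euclideanSpace, Fintype.card_fin]
  congr 1 <;> ring

theorem integrable_gaussDensity (q : Param d) : Integrable (gaussDensity q) := by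
  have h := (integrable_gauss_iff q fun _ => (1 : ℝ)).1
    ((gaussIntegrable_const (1 : ℝ)).integrable_gauss q)
  simpa using h

instance : IsProbabilityMeasure (gauss (stdParam : Param d)) := ⟨by
  rw [gauss, withDensity_apply _ MeasurableSet.univ, Measure.restrict_univ,
    ← ofReal_integral_eq_lintegral_ofReal (integrable_gaussDensity _)
      (Filter.Eventually.of_forall fun x => (gaussDensity_pos _ x).le),
    integral_gaussDensity_stdParam, ENNReal.ofReal_one]⟩

instance (q : Param d) : IsProbabilityMeasure (gauss q) := by
  obtain ⟨B, hB, h⟩ := exists_eq_transpose_mul_self q.posDef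
  rw [gauss_eq_map_gauss stdParam q (A := B.transpose) (by simpa using hB) (by simp [stdParam, h])]
  exact Measure.isProbabilityMeasure_map (continuous_affine _ _ _).aemeasurable

/-! ### Gaussian integration by parts -/

theorem hasFDerivAt_quad (p : Param d) (x : EuclideanSpace ℝ (Fin d)) :
    HasFDerivAt (quad p) (innerSL ℝ (act p.cov⁻¹ (x - p.mean))) x := by
  have h1 := (hasFDerivAt_id (𝕜 := ℝ) x).sub_const p.mean
  have h2 := ((Matrix.toEuclideanCLM (𝕜 := ℝ) p.cov⁻¹).hasFDerivAt (x := x - p.mean)).comp x h1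
  have h3 := (h1.inner ℝ h2).const_mul (1 / 2)
  refine h3.congr_fderiv ?_
  ext v
  simp [← act_eq_toEuclideanCLM, fderivInnerCLM_apply]
  rw [← p.transpose_inv, ← inner_act_left, p.transpose_inv, real_inner_comm]
  ring

theorem fderiv_gaussDensity (p : Param d) (x v : EuclideanSpace ℝ (Fin d)) :
    fderiv ℝ (gaussDensity p) x v =
      -inner ℝ (act p.cov⁻¹ (x - p.mean)) v * gaussDensity p x := by
  have h := ((hasFDerivAt_quad p x).neg.exp).mul_const (partition p)⁻¹
  have h' : HasFDerivAt (gaussDensity p) _ x :=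
    h.congr_of_eventuallyEq (Filter.Eventually.of_forall fun y => by
      rw [gaussDensity_eq, div_eq_mul_inv]; rfl)
  rw [h'.fderiv, gaussDensity_eq]
  simp
  ring

theorem differentiable_gaussDensity (p : Param d) : Differentiable ℝ (gaussDensity p) := by
  have h : Differentiable ℝ (quad p) := fun x => (hasFDerivAt_quad p x).differentiableAt
  simp only [funext (gaussDensity_eq p)]
  fun_prop

/-- Stein's identity: in the direction `Σ u` the logarithmic derivative of the density is
`-(x - m) · u`, so this is integration by parts. -/
theorem integral_mul_inner_gauss (p : Param d) {f : EuclideanSpace ℝ (Fin d) → ℝ}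
    (hf : Differentiable ℝ f) (hfi : GaussIntegrable f) (u : EuclideanSpace ℝ (Fin d))
    (hfi' : GaussIntegrable fun x => fderiv ℝ f x (act p.cov u)) :
    ∫ x, f x * inner ℝ (x - p.mean) u ∂(gauss p) =
      ∫ x, fderiv ℝ f x (act p.cov u) ∂(gauss p) := by
  have hd : ∀ x, f x * fderiv ℝ (gaussDensity p) x (act p.cov u) =
      -(gaussDensity p x • (f x * inner ℝ (x - p.mean) u)) := fun x => by
    rw [fderiv_gaussDensity, inner_act_left, p.transpose_inv, ← act_mul, p.inv_mul_cov, act_one,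
      smul_eq_mul]
    ring
  have i1 := (integrable_gauss_iff p _).1 (hfi'.integrable_gauss p)
  have i2 := (integrable_gauss_iff p _).1 ((hfi.mul_inner p.mean u).integrable_gauss p)
  have i3 := (integrable_gauss_iff p _).1 (hfi.integrable_gauss p)
  have h := integral_mul_fderiv_eq_neg_fderiv_mul_of_integrable (μ := volume) (f := f)
    (g := gaussDensity p) (v := act p.cov u)
    (by simpa only [smul_eq_mul, mul_comm] using i1)
    (by simp only [hd]; exact i2.neg)
    (by simpa only [smul_eq_mul, mul_comm] using i3)
    (fun x _ => hf x) (fun x _ => differentiable_gaussDensity p x)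
  simp only [hd, integral_neg, neg_inj] at h
  rw [integral_gauss, integral_gauss, h]
  simp only [smul_eq_mul, mul_comm]

theorem integral_inner_gauss (p : Param d) (u : EuclideanSpace ℝ (Fin d)) :
    ∫ x, inner ℝ (x - p.mean) u ∂(gauss p) = 0 := by
  have h := integral_mul_inner_gauss p (f := fun _ => 1) (by fun_prop) (gaussIntegrable_const 1) u
    (by simpa using gaussIntegrable_const (0 : ℝ))
  simpa using h

theorem fderiv_inner_sub (m v x w : EuclideanSpace ℝ (Fin d)) :
    fderiv ℝ (fun x : EuclideanSpace ℝ (Fin d) => inner ℝ (x - m) v) x w = inner ℝ w v := by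
  have h : HasFDerivAt (fun x : EuclideanSpace ℝ (Fin d) => inner ℝ (x - m) v) _ x :=
    ((hasFDerivAt_id x).sub_const m).inner ℝ (hasFDerivAt_const v x)
  rw [h.fderiv]
  simp [fderivInnerCLM_apply]

theorem gaussIntegrable_inner (m v : EuclideanSpace ℝ (Fin d)) :
    GaussIntegrable fun x : EuclideanSpace ℝ (Fin d) => inner ℝ (x - m) v := by
  simpa using (gaussIntegrable_const (1 : ℝ)).mul_inner m v

theorem differentiable_inner_sub (m v : EuclideanSpace ℝ (Fin d)) :
    Differentiable ℝ fun x : EuclideanSpace ℝ (Fin d) => inner ℝ (x - m) v :=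
  fun x => (((hasFDerivAt_id x).sub_const m).inner ℝ (hasFDerivAt_const v x)).differentiableAt

theorem integral_inner_mul_inner_gauss (p : Param d) (u v : EuclideanSpace ℝ (Fin d)) :
    ∫ x, inner ℝ (x - p.mean) v * inner ℝ (x - p.mean) u ∂(gauss p) =
      inner ℝ (act p.cov u) v := by
  rw [integral_mul_inner_gauss p (differentiable_inner_sub p.mean v)
    (gaussIntegrable_inner p.mean v) u
    (by simp only [fderiv_inner_sub]; exact gaussIntegrable_const _)]
  simp only [fderiv_inner_sub]
  simp

/-- The quadratic form of `M` in orthonormal coordinates. -/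
theorem inner_act_act_eq_sum (M P : Matrix (Fin d) (Fin d) ℝ) (hP : P.transpose = P)
    (y : EuclideanSpace ℝ (Fin d)) :
    inner ℝ (act P y) (act M (act P y)) = ∑ i, ∑ j, M i j *
      (inner ℝ y (act P (EuclideanSpace.single i 1)) *
        inner ℝ y (act P (EuclideanSpace.single j 1))) := by
  have h : ∀ i, inner ℝ y (act P (EuclideanSpace.single i 1)) = act P y i := fun i => by
    nth_rewrite 1 [← hP]
    rw [← inner_act_left, EuclideanSpace.inner_single_right]
    simp
  simp only [h, PiLp.inner_apply, act_apply M, RCLike.inner_apply, conj_trivial, Finset.sum_mul]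
  exact Finset.sum_congr rfl fun i _ => Finset.sum_congr rfl fun j _ => by ring

theorem integrable_inner_act (p : Param d) (M : Matrix (Fin d) (Fin d) ℝ) :
    Integrable (fun x => inner ℝ (x - p.mean) (act M (x - p.mean))) (gauss p) := by
  have h := fun x => inner_act_act_eq_sum M 1 (by simp) (x - p.mean)
  simp only [act_one] at h
  simp only [h]
  exact integrable_finsetSum _ fun i _ => integrable_finsetSum _ fun j _ =>
    (((gaussIntegrable_inner p.mean _).mul_inner p.mean _).integrable_gauss p).const_mul _

/-- The second moments of a Gaussian. -/
theorem integral_inner_act_gauss (p : Param d) (M : Matrix (Fin d) (Fin d) ℝ) :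
    ∫ x, inner ℝ (x - p.mean) (act M (x - p.mean)) ∂(gauss p) = (M * p.cov).trace := by
  have h := fun x => inner_act_act_eq_sum M 1 (by simp) (x - p.mean)
  simp only [act_one] at h
  have hi : ∀ u v, Integrable (fun x => inner ℝ (x - p.mean) v * inner ℝ (x - p.mean) u)
      (gauss p) := fun u v =>
    ((gaussIntegrable_inner p.mean v).mul_inner p.mean u).integrable_gauss p
  simp_rw [h]
  refine (integral_finsetSum _ fun i _ => integrable_finsetSum _ fun j _ =>
    (hi _ _).const_mul _).trans ?_
  simp_rw [integral_finsetSum _ fun j _ => (hi _ _).const_mul _, integral_const_mul,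
    integral_inner_mul_inner_gauss, real_inner_comm, inner_single_act_single]
  simp only [Matrix.trace, Matrix.diag, Matrix.mul_apply]
  refine Finset.sum_congr rfl fun i _ => Finset.sum_congr rfl fun j _ => ?_
  rw [← p.transpose_cov, Matrix.transpose_apply, p.transpose_cov]

theorem integral_quad (p : Param d) : ∫ x, quad p x ∂(gauss p) = d / 2 := by
  simp only [quad]
  rw [integral_const_mul, integral_inner_act_gauss, p.inv_mul_cov]
  simp
  ring

variable {V : EuclideanSpace ℝ (Fin d) → ℝ}

/-! ### The energy as a real-valued function -/

/-- The driving energy as a real number: the potential energy minus the differential entropy. The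
term `d / 2` is the average of the exponent `quad p` under the Gaussian itself. -/
noncomputable def realEnergy (V : EuclideanSpace ℝ (Fin d) → ℝ) (p : Param d) : ℝ :=
  ∫ x, V x ∂(gauss p) - d / 2 - Real.log (partition p)

theorem gauss_eq_withDensity_target (hV : Continuous V) (p : Param d) :
    gauss p = (target V).withDensity
      fun x => ENNReal.ofReal (gaussDensity p x * Real.exp (V x)) := by
  have h1 := continuous_gaussDensity p
  rw [gauss, target, ← withDensity_mul _ (by fun_prop) (by fun_prop)]
  congr 1
  ext x
  rw [Pi.mul_apply, ← ENNReal.ofReal_mul (Real.exp_pos _).le]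
  congr 1
  have : Real.exp (-V x) * Real.exp (V x) = 1 := by rw [← Real.exp_add]; simp
  linear_combination -gaussDensity p x * this

theorem llr_gauss_target (hV : Continuous V) [IsProbabilityMeasure (target V)] (p : Param d) :
    llr (gauss p) (target V) =ᵐ[gauss p]
      fun x => V x - quad p x - Real.log (partition p) := by
  have h1 := continuous_gaussDensity p
  have hac : gauss p ≪ target V := by
    rw [gauss_eq_withDensity_target hV p]
    exact withDensity_absolutelyContinuous _ _
  have h : (gauss p).rnDeriv (target V) =ᵐ[target V]
      fun x => ENNReal.ofReal (gaussDensity p x * Real.exp (V x)) := by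
    conv_lhs => rw [gauss_eq_withDensity_target hV p]
    exact Measure.rnDeriv_withDensity _ (by fun_prop)
  filter_upwards [hac.ae_le h] with x hx
  rw [llr, hx, ENNReal.toReal_ofReal (mul_pos (gaussDensity_pos p x) (Real.exp_pos _)).le,
    Real.log_mul (gaussDensity_pos p x).ne' (Real.exp_pos _).ne', Real.log_exp, gaussDensity_eq,
    Real.log_div (Real.exp_pos _).ne' (partition_pos p).ne', Real.log_exp]
  ring

theorem gaussIntegrable_quad (p : Param d) : GaussIntegrable (quad p) := by
  open scoped Matrix.Norms.L2Operator in
  refine (gaussIntegrable_const (1 : ℝ)).of_norm_le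
    (contDiff_quad p).continuous.aestronglyMeasurable (‖p.cov⁻¹‖ * (1 + ‖p.mean‖ ^ 2)) fun x => ?_
  have h1 : ‖inner ℝ (x - p.mean) (act p.cov⁻¹ (x - p.mean))‖ ≤
      ‖x - p.mean‖ * (‖p.cov⁻¹‖ * ‖x - p.mean‖) :=
    (norm_inner_le_norm _ _).trans (by gcongr; exact norm_act_le _ _)
  have h2 : ‖x - p.mean‖ ^ 2 ≤ 2 * ((1 + ‖p.mean‖ ^ 2) * (1 + ‖x‖ ^ 2)) := by
    have := norm_sub_le x p.mean
    nlinarith [sq_nonneg (‖x‖ - ‖p.mean‖), norm_nonneg (x - p.mean),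
      sq_nonneg (‖x‖ * ‖p.mean‖)]
  rw [quad, norm_mul, norm_one, mul_one, Real.norm_of_nonneg (by norm_num)]
  nlinarith [mul_le_mul_of_nonneg_left h2 (norm_nonneg p.cov⁻¹)]

theorem energy_eq_ofReal_realEnergy (hV : Continuous V) [IsProbabilityMeasure (target V)]
    (hVi : GaussIntegrable V) (p : Param d) :
    energy V p = ENNReal.ofReal (realEnergy V p) := by
  have hac : gauss p ≪ target V := by
    rw [gauss_eq_withDensity_target hV p]
    exact withDensity_absolutelyContinuous _ _
  have hq := (gaussIntegrable_quad p).integrable_gauss p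
  have hv := hVi.integrable_gauss p
  have hi : Integrable (fun x => V x - quad p x - Real.log (partition p)) (gauss p) :=
    (hv.sub hq).sub (integrable_const _)
  have hl := llr_gauss_target hV p
  rw [energy, InformationTheory.klDiv_of_ac_of_integrable hac (hi.congr hl.symm),
    integral_congr_ae hl, integral_sub (f := fun x => V x - quad p x) (hv.sub hq)
      (integrable_const _), integral_sub hv hq, integral_quad]
  simp [realEnergy]

/-! ### Derivatives of the potential -/

/-- No differentiability is needed: where it fails, both sides are zero. -/
theorem inner_gradient (x v : EuclideanSpace ℝ (Fin d)) :
    inner ℝ (gradient V x) v = fderiv ℝ V x v := by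
  rw [gradient, InnerProductSpace.toDual_symm_apply]

theorem fderiv_fderiv_apply (hV : ContDiff ℝ 2 V) (x w v : EuclideanSpace ℝ (Fin d)) :
    fderiv ℝ (fun y => fderiv ℝ V y v) x w = fderiv ℝ (fderiv ℝ V) x w v := by
  have h : DifferentiableAt ℝ (fderiv ℝ V) x :=
    (hV.fderiv_right (m := 1) (by norm_num)).differentiable one_ne_zero x
  rw [fderiv_clm_apply h (by fun_prop)]
  simp

theorem eq_sum_smul_single (w : EuclideanSpace ℝ (Fin d)) :
    w = ∑ i, w i • EuclideanSpace.single i (1 : ℝ) := by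
  simpa using! ((EuclideanSpace.basisFun (Fin d) ℝ).sum_repr w).symm

theorem fderiv_fderiv_single (w x : EuclideanSpace ℝ (Fin d)) (j : Fin d) :
    fderiv ℝ (fderiv ℝ V) x w (EuclideanSpace.single j 1) = ∑ i, w i * hess V x i j := by
  conv_lhs => rw [eq_sum_smul_single w]
  simp [hess, map_sum]

theorem transpose_hess (hV : ContDiff ℝ 2 V) (x : EuclideanSpace ℝ (Fin d)) :
    (hess V x).transpose = hess V x := by
  ext i j
  exact (hV.contDiffAt.isSymmSndFDerivAt (by simp)) _ _

theorem transpose_meanHess (hV : ContDiff ℝ 2 V) (p : Param d) :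
    (meanHess V p).transpose = meanHess V p := by
  ext i j
  simp only [meanHess, Matrix.transpose_apply, Matrix.of_apply]
  congr 1
  ext x
  nth_rewrite 1 [← transpose_hess hV]
  rfl

theorem gaussIntegrable_inner_left {g : EuclideanSpace ℝ (Fin d) → EuclideanSpace ℝ (Fin d)}
    (hg : GaussIntegrable g) (v : EuclideanSpace ℝ (Fin d)) :
    GaussIntegrable fun x => inner ℝ (g x) v := by
  refine hg.of_norm_le (hg.aestronglyMeasurable.inner aestronglyMeasurable_const) ‖v‖ fun x => ?_
  refine (norm_inner_le_norm _ _).trans ?_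
  nlinarith [mul_nonneg (mul_nonneg (norm_nonneg v) (norm_nonneg (g x))) (sq_nonneg ‖x‖)]

theorem gaussIntegrable_fderiv (hg : GaussIntegrable (gradient V))
    (v : EuclideanSpace ℝ (Fin d)) : GaussIntegrable fun x => fderiv ℝ V x v := by
  simpa only [inner_gradient] using gaussIntegrable_inner_left hg v

theorem integral_fderiv_gauss (hg : GaussIntegrable (gradient V))
    (p : Param d) (v : EuclideanSpace ℝ (Fin d)) :
    ∫ x, fderiv ℝ V x v ∂(gauss p) = inner ℝ (meanGrad V p) v := by
  rw [meanGrad, real_inner_comm, ← integral_inner (hg.integrable_gauss p)]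
  simp only [real_inner_comm (gradient V _) v, inner_gradient]

theorem gaussIntegrable_fderiv_fderiv
    (hH : ∀ i j, GaussIntegrable fun x => hess V x i j) (w : EuclideanSpace ℝ (Fin d))
    (j : Fin d) : GaussIntegrable fun x =>
      fderiv ℝ (fderiv ℝ V) x w (EuclideanSpace.single j 1) := by
  intro c hc
  simp only [fderiv_fderiv_single, smul_eq_mul, Finset.mul_sum]
  refine integrable_finsetSum _ fun i _ => ?_
  refine ((hH i j c hc).const_mul (w i)).congr (Filter.Eventually.of_forall fun x => ?_)
  simp only [smul_eq_mul]
  ring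

theorem integral_fderiv_fderiv_gauss (hH : ∀ i j, GaussIntegrable fun x => hess V x i j)
    (p : Param d) (w : EuclideanSpace ℝ (Fin d)) (j : Fin d) :
    ∫ x, fderiv ℝ (fderiv ℝ V) x w (EuclideanSpace.single j 1) ∂(gauss p) =
      ∑ i, w i * meanHess V p i j := by
  simp only [fderiv_fderiv_single, meanHess, Matrix.of_apply]
  rw [integral_finsetSum _ fun i _ => ((hH i j).integrable_gauss p).const_mul _]
  simp only [integral_const_mul]

/-- Stein's identity for a partial derivative of the potential. -/
theorem integral_fderiv_mul_inner_gauss (hV : ContDiff ℝ 2 V)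
    (hg : GaussIntegrable (gradient V)) (hH : ∀ i j, GaussIntegrable fun x => hess V x i j)
    (p : Param d) (u : EuclideanSpace ℝ (Fin d)) (j : Fin d) :
    ∫ x, fderiv ℝ V x (EuclideanSpace.single j 1) * inner ℝ (x - p.mean) u ∂(gauss p) =
      ∑ i, act p.cov u i * meanHess V p i j := by
  have h1 : Differentiable ℝ (fderiv ℝ V) :=
    (hV.fderiv_right (m := 1) (by norm_num)).differentiable one_ne_zero
  rw [integral_mul_inner_gauss p (by fun_prop)
    (gaussIntegrable_fderiv hg _) u]
  · simp only [fderiv_fderiv_apply hV]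
    exact integral_fderiv_fderiv_gauss hH p _ j
  · simp only [fderiv_fderiv_apply hV]
    exact gaussIntegrable_fderiv_fderiv hH _ j

theorem gradient_inner_act_eq_sum (B : Matrix (Fin d) (Fin d) ℝ)
    (x y : EuclideanSpace ℝ (Fin d)) :
    inner ℝ (gradient V x) (act B y) = ∑ j, fderiv ℝ V x (EuclideanSpace.single j 1) *
      inner ℝ y (act B.transpose (EuclideanSpace.single j 1)) := by
  rw [inner_gradient]
  conv_lhs => rw [eq_sum_smul_single (act B y)]
  simp only [map_sum, map_smul, smul_eq_mul]
  refine Finset.sum_congr rfl fun j _ => ?_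
  rw [← inner_act_left, EuclideanSpace.inner_single_right]
  simp [mul_comm]

theorem integrable_gradient_inner_act
    (hg : GaussIntegrable (gradient V)) (p : Param d) (B : Matrix (Fin d) (Fin d) ℝ) :
    Integrable (fun x => inner ℝ (gradient V x) (act B (x - p.mean))) (gauss p) := by
  simp only [gradient_inner_act_eq_sum]
  exact integrable_finsetSum _ fun j _ =>
    ((gaussIntegrable_fderiv hg _).mul_inner _ _).integrable_gauss p

theorem integral_gradient_inner_act (hV : ContDiff ℝ 2 V)
    (hg : GaussIntegrable (gradient V)) (hH : ∀ i j, GaussIntegrable fun x => hess V x i j)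
    (p : Param d) (B : Matrix (Fin d) (Fin d) ℝ) :
    ∫ x, inner ℝ (gradient V x) (act B (x - p.mean)) ∂(gauss p) =
      (B * p.cov * meanHess V p).trace := by
  simp only [gradient_inner_act_eq_sum]
  rw [integral_finsetSum _ fun j _ =>
    ((gaussIntegrable_fderiv hg _).mul_inner _ _).integrable_gauss p]
  simp only [integral_fderiv_mul_inner_gauss hV hg hH, ← act_mul]
  simp only [Matrix.trace, Matrix.diag]
  refine Finset.sum_congr rfl fun j _ => ?_
  rw [Matrix.mul_apply]
  refine Finset.sum_congr rfl fun i _ => ?_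
  congr 1
  have h : p.cov * B.transpose = (B * p.cov).transpose := by
    rw [Matrix.transpose_mul, p.transpose_cov]
  rw [h]
  simp [act_apply, -Matrix.transpose_mul]

/-- The tangent plane inequality of a `lam`-convex function. -/
theorem add_inner_add_sq_le {lam : ℝ} (hV : Differentiable ℝ V)
    (hconv : ConvexOn ℝ Set.univ (fun x => V x - lam / 2 * ‖x‖ ^ 2))
    (x y : EuclideanSpace ℝ (Fin d)) :
    V x + inner ℝ (gradient V x) (y - x) + lam / 2 * ‖y - x‖ ^ 2 ≤ V y := by
  have hline : ∀ t : ℝ, HasDerivAt (fun t : ℝ => x + t • (y - x)) (y - x) t := fun t => by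
    simpa using! ((hasDerivAt_id t).smul_const (y - x)).const_add x
  have h1 : HasDerivAt (fun t : ℝ => V (x + t • (y - x))) (fderiv ℝ V x (y - x)) 0 := by
    have := (hV (x + (0 : ℝ) • (y - x))).hasFDerivAt.comp_hasDerivAt 0 (hline 0)
    simpa using! this
  have h2 := ((hline 0).norm_sq).const_mul (lam / 2)
  have hc : ConvexOn ℝ Set.univ
      (fun t : ℝ => V (x + t • (y - x)) - lam / 2 * ‖x + t • (y - x)‖ ^ 2) := by
    have := hconv.comp_affineMap (AffineMap.lineMap (k := ℝ) x y)
    simpa [Function.comp_def, AffineMap.lineMap_apply, add_comm] using! this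
  have h3 := hc.le_slope_of_hasDerivAt (Set.mem_univ 0) (Set.mem_univ 1) one_pos (h1.sub h2)
  rw [slope_def_field] at h3
  simp only [zero_smul, add_zero, one_smul, add_sub_cancel, sub_zero, div_one] at h3
  rw [inner_gradient]
  have h4 : ‖y‖ ^ 2 = ‖x‖ ^ 2 + 2 * inner ℝ x (y - x) + ‖y - x‖ ^ 2 := by
    rw [← norm_add_sq_real, add_sub_cancel]
  rw [h4] at h3
  linarith

/-! ### Sublevels of the energy -/

theorem log_partition (p : Param d) : Real.log (partition p) =
    d / 2 * Real.log (2 * Real.pi) +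
      ∑ i, 1 / 2 * Real.log (p.posDef.isHermitian.eigenvalues i) := by
  have h1 : (p.cov.det : ℝ) = ∏ i, p.posDef.isHermitian.eigenvalues i := by
    simpa using p.posDef.isHermitian.det_eq_prod_eigenvalues
  rw [partition, Real.log_sqrt (by
      rw [Matrix.det_smul]
      have := p.posDef.det_pos
      positivity),
    Matrix.det_smul, Real.log_mul (by positivity) p.det_ne_zero, h1,
    Real.log_prod fun i _ => (p.posDef.eigenvalues_pos i).ne', Real.log_pow, ← Finset.mul_sum]
  simp
  ring

theorem integral_norm_sq_gauss (p : Param d) :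
    ∫ x, ‖x‖ ^ 2 ∂(gauss p) = p.cov.trace + ‖p.mean‖ ^ 2 := by
  have h : ∀ x : EuclideanSpace ℝ (Fin d), ‖x‖ ^ 2 = inner ℝ (x - p.mean) (act 1 (x - p.mean)) +
      2 * inner ℝ (x - p.mean) p.mean + ‖p.mean‖ ^ 2 := fun x => by
    conv_lhs => rw [← sub_add_cancel x p.mean, norm_add_sq_real]
    rw [act_one, real_inner_self_eq_norm_sq]
  have i1 := integrable_inner_act p 1
  have i2 : Integrable (fun x => 2 * inner ℝ (x - p.mean) p.mean) (gauss p) :=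
    ((gaussIntegrable_inner p.mean _).integrable_gauss p).const_mul _
  rw [integral_congr_ae (Filter.Eventually.of_forall h),
    integral_add (f := fun x => inner ℝ (x - p.mean) (act 1 (x - p.mean)) +
      2 * inner ℝ (x - p.mean) p.mean) (i1.add i2) (integrable_const _), integral_add i1 i2,
    integral_inner_act_gauss, integral_const_mul, integral_inner_gauss]
  simp

theorem gaussIntegrable_norm_sq :
    GaussIntegrable fun x : EuclideanSpace ℝ (Fin d) => ‖x‖ ^ 2 :=
  (gaussIntegrable_const (1 : ℝ)).of_norm_le (by fun_prop) 1 fun x => by simp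

/-- The energy is coercive: it dominates a sum of one function of the mean and one function of each
eigenvalue of the covariance. -/
theorem exists_le_realEnergy {lam : ℝ} (hlam : 0 < lam) (hV : Differentiable ℝ V)
    (hconv : ConvexOn ℝ Set.univ (fun x => V x - lam / 2 * ‖x‖ ^ 2))
    (hVi : GaussIntegrable V) :
    ∃ C : ℝ, ∀ p : Param d, lam / 4 * ‖p.mean‖ ^ 2 +
      ∑ i, (lam / 4 * p.posDef.isHermitian.eigenvalues i -
        1 / 2 * Real.log (p.posDef.isHermitian.eigenvalues i)) ≤ realEnergy V p + C := by
  have hlow : ∀ x, lam / 4 * ‖x‖ ^ 2 + (V 0 - ‖gradient V 0‖ ^ 2 / lam) ≤ V x := fun x => by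
    have h1 := add_inner_add_sq_le hV hconv 0 x
    have h2 := (abs_le.1 (abs_real_inner_le_norm (gradient V 0) x)).1
    rw [sub_zero] at h1
    have h3 : ‖gradient V 0‖ * ‖x‖ ≤ lam / 4 * ‖x‖ ^ 2 + ‖gradient V 0‖ ^ 2 / lam := by
      have : lam / 4 * ‖x‖ ^ 2 + ‖gradient V 0‖ ^ 2 / lam - ‖gradient V 0‖ * ‖x‖ =
          (lam / 2 * ‖x‖ - ‖gradient V 0‖) ^ 2 / lam := by field_simp; ring
      have h4 : 0 ≤ (lam / 2 * ‖x‖ - ‖gradient V 0‖) ^ 2 / lam := by positivity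
      linarith
    linarith
  refine ⟨‖gradient V 0‖ ^ 2 / lam - V 0 + d / 2 + d / 2 * Real.log (2 * Real.pi), fun p => ?_⟩
  have i1 := (gaussIntegrable_norm_sq.integrable_gauss p).const_mul (lam / 4)
  have h := integral_mono (i1.add (integrable_const (V 0 - ‖gradient V 0‖ ^ 2 / lam)))
    (hVi.integrable_gauss p) hlow
  simp only [Pi.add_apply] at h
  rw [integral_add i1 (integrable_const _), integral_const_mul, integral_norm_sq_gauss] at h
  have htr : p.cov.trace = ∑ i, p.posDef.isHermitian.eigenvalues i := by
    simpa using p.posDef.isHermitian.trace_eq_sum_eigenvalues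
  simp only [integral_const, probReal_univ, one_smul, htr] at h
  rw [realEnergy, log_partition, Finset.sum_sub_distrib, ← Finset.mul_sum]
  linarith

theorem exists_sublevelBound {lam : ℝ} (hlam : 0 < lam) (hV : Differentiable ℝ V)
    (hconv : ConvexOn ℝ Set.univ (fun x => V x - lam / 2 * ‖x‖ ^ 2))
    [IsProbabilityMeasure (target V)] (hVi : GaussIntegrable V) {E : ENNReal} (hE : E ≠ ⊤) :
    ∃ r : ℝ, 0 < r ∧ SublevelBound V E r := by
  obtain ⟨C, hC⟩ := exists_le_realEnergy hlam hV hconv hVi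
  set k : ℝ := 1 / 2 * (1 + Real.log (lam / 4))
  -- this is `log y ≤ y - 1` at `y = lam / 4 * s`, leaving a multiple of `s` to spare
  have hk : ∀ s : ℝ, 0 < s → lam / 8 * s + k ≤ lam / 4 * s - 1 / 2 * Real.log s := fun s hs => by
    have h1 := Real.log_le_sub_one_of_pos (show 0 < lam / 4 * s by positivity)
    rw [Real.log_mul (by positivity) hs.ne'] at h1
    simp only [k]
    linarith
  -- every summand of the coercive lower bound is at most `M` on the sublevel
  set M : ℝ := |E.toReal + C| + d * |k|
  have hM : 0 ≤ M := by positivity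
  -- the three terms bound `σ⁻¹`, `σ` and the norm of the mean
  refine ⟨Real.exp (2 * M) + 8 * (M + |k|) / lam + (4 * M / lam + 1), by positivity,
    fun p hp => ?_⟩
  set σ := p.posDef.isHermitian.eigenvalues
  have hσ : ∀ i, 0 < σ i := p.posDef.eigenvalues_pos
  have he : realEnergy V p ≤ E.toReal := by
    rw [energy_eq_ofReal_realEnergy hV.continuous hVi] at hp
    exact (ENNReal.ofReal_le_iff_le_toReal hE).1 hp
  have hlow : ∀ i, -|k| ≤ lam / 4 * σ i - 1 / 2 * Real.log (σ i) := fun i => by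
    have := hk _ (hσ i)
    have := neg_abs_le k
    have : 0 ≤ lam / 8 * σ i := mul_nonneg (by positivity) (hσ i).le
    linarith
  have htot : lam / 4 * ‖p.mean‖ ^ 2 +
      ∑ i, (lam / 4 * σ i - 1 / 2 * Real.log (σ i) + |k|) ≤ M := by
    rw [Finset.sum_add_distrib]
    simp only [Finset.sum_const, Finset.card_univ, Fintype.card_fin, nsmul_eq_mul]
    have := hC p
    have := le_abs_self (E.toReal + C)
    simp only [M]
    linarith
  have hpos : ∀ i, 0 ≤ lam / 4 * σ i - 1 / 2 * Real.log (σ i) + |k| := fun i => by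
    linarith [hlow i]
  have hM1 : 0 ≤ 8 * (M + |k|) / lam := by positivity
  have hM2 : 0 ≤ 4 * M / lam := by positivity
  have hM3 := Real.exp_pos (2 * M)
  refine ⟨fun i => ?_, ?_⟩
  · have h1 : lam / 4 * σ i - 1 / 2 * Real.log (σ i) + |k| ≤ M := by
      have h2 := Finset.single_le_sum (fun j _ => hpos j) (Finset.mem_univ i)
      have : 0 ≤ lam / 4 * ‖p.mean‖ ^ 2 := by positivity
      linarith
    have h3 := hk _ (hσ i)
    constructor
    · have h4 : -(2 * M) ≤ Real.log (σ i) := by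
        have : 0 ≤ lam / 4 * σ i := mul_nonneg (by positivity) (hσ i).le
        have := abs_nonneg k
        linarith
      have h5 : Real.exp (-(2 * M)) ≤ σ i := (Real.le_log_iff_exp_le (hσ i)).1 h4
      refine le_trans ?_ h5
      rw [Real.exp_neg]
      gcongr
      linarith
    · have h6 : σ i ≤ 8 * (M + |k|) / lam := by
        rw [le_div_iff₀ hlam]
        have := neg_abs_le k
        linarith [abs_nonneg k]
      linarith
  · have h1 : ‖p.mean‖ ^ 2 ≤ 4 * M / lam := by
      rw [le_div_iff₀ hlam]
      have := Finset.sum_nonneg fun i (_ : i ∈ Finset.univ) => hpos i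
      linarith
    nlinarith [sq_nonneg (‖p.mean‖ - 1), norm_nonneg p.mean]

/-! ### The gradient-domination inequality -/

open scoped MatrixOrder in
/-- The optimal linear transport between two positive definite matrices. -/
theorem exists_posDef_mul_mul_eq {S T : Matrix (Fin d) (Fin d) ℝ} (hS : S.PosDef)
    (hT : T.PosDef) : ∃ A : Matrix (Fin d) (Fin d) ℝ, A.PosDef ∧ A * S * A = T := by
  obtain ⟨X, hX, rfl⟩ := exists_eq_transpose_mul_self hS
  have hXd : IsUnit X.det := (Matrix.isUnit_iff_isUnit_det _).1 hX
  have hQ : (X * T * X.transpose).PosDef := by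
    simpa [Matrix.star_eq_conjTranspose] using
      (Matrix.IsUnit.posDef_star_right_conjugate_iff hX).2 hT
  have hR : (CFC.sqrt (X * T * X.transpose)).PosDef :=
    Matrix.isStrictlyPositive_iff_posDef.1 (IsStrictlyPositive.sqrt _ hQ.isStrictlyPositive)
  have hRR : CFC.sqrt (X * T * X.transpose) * CFC.sqrt (X * T * X.transpose) =
      X * T * X.transpose := CFC.sqrt_mul_sqrt_self _ hQ.posSemidef.nonneg
  have hXi : IsUnit X⁻¹ := by
    rw [Matrix.isUnit_iff_isUnit_det]
    exact Matrix.isUnit_nonsing_inv_det _ hXd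
  refine ⟨X⁻¹ * CFC.sqrt (X * T * X.transpose) * X⁻¹.transpose, ?_, ?_⟩
  · simpa [Matrix.star_eq_conjTranspose] using
      (Matrix.IsUnit.posDef_star_right_conjugate_iff hXi).2 hR
  · have h1 : X⁻¹ * X = 1 := Matrix.nonsing_inv_mul _ hXd
    have h2 : X * X⁻¹ = 1 := Matrix.mul_nonsing_inv _ hXd
    have h3 : X⁻¹.transpose * X.transpose = 1 := by
      rw [← Matrix.transpose_mul, h2, Matrix.transpose_one]
    have h4 : X.transpose * X⁻¹.transpose = 1 := by
      rw [← Matrix.transpose_mul, h1, Matrix.transpose_one]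
    set R := CFC.sqrt (X * T * X.transpose)
    calc X⁻¹ * R * X⁻¹.transpose * (X.transpose * X) * (X⁻¹ * R * X⁻¹.transpose)
        = X⁻¹ * R * (X⁻¹.transpose * X.transpose) * (X * X⁻¹) * R * X⁻¹.transpose := by
          simp only [Matrix.mul_assoc]
      _ = X⁻¹ * (R * R) * X⁻¹.transpose := by
          rw [h2, h3, Matrix.mul_one, Matrix.mul_one]; simp only [Matrix.mul_assoc]
      _ = (X⁻¹ * X) * T * (X.transpose * X⁻¹.transpose) := by
          rw [hRR]; simp only [Matrix.mul_assoc]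
      _ = T := by rw [h1, h4, Matrix.one_mul, Matrix.mul_one]

theorem log_det_le_trace_sub {A : Matrix (Fin d) (Fin d) ℝ} (hA : A.PosDef) :
    Real.log A.det ≤ A.trace - d := by
  have h1 : (A.det : ℝ) = ∏ i, hA.isHermitian.eigenvalues i := by
    simpa using hA.isHermitian.det_eq_prod_eigenvalues
  have h2 : A.trace = ∑ i, hA.isHermitian.eigenvalues i := by
    simpa using hA.isHermitian.trace_eq_sum_eigenvalues
  rw [h1, h2, Real.log_prod fun i _ => (hA.eigenvalues_pos i).ne']
  calc _ ≤ ∑ i, (hA.isHermitian.eigenvalues i - 1) :=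
        Finset.sum_le_sum fun i _ => Real.log_le_sub_one_of_pos (hA.eigenvalues_pos i)
    _ = _ := by simp [Finset.sum_sub_distrib]

/-- The energy of the image of a Gaussian under an affine map, bounded below by its first-order
expansion and a quadratic term. This is displacement convexity along Gaussians. -/
theorem realEnergy_add_le {lam : ℝ} (hV : ContDiff ℝ 2 V)
    (hconv : ConvexOn ℝ Set.univ (fun x => V x - lam / 2 * ‖x‖ ^ 2))
    (hVi : GaussIntegrable V) (hg : GaussIntegrable (gradient V))
    (hH : ∀ i j, GaussIntegrable fun x => hess V x i j)
    (p q : Param d) {B : Matrix (Fin d) (Fin d) ℝ} (hA : (1 + B).PosDef)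
    (h : (1 + B) * p.cov * (1 + B) = q.cov) :
    realEnergy V p + inner ℝ (meanGrad V p) (q.mean - p.mean) +
      (B * p.cov * meanHess V p).trace - B.trace +
      lam / 2 * (‖q.mean - p.mean‖ ^ 2 + (B.transpose * B * p.cov).trace) ≤ realEnergy V q := by
  set δ := q.mean - p.mean
  have hAT : (1 + B).transpose = 1 + B := by simpa using hA.isHermitian.eq
  have h' : (1 + B) * p.cov * (1 + B).transpose = q.cov := by rw [hAT, h]
  have hmap := gauss_eq_map_gauss p q hA.isUnit h'
  have haff := (continuous_affine p q (1 + B)).aemeasurable (μ := gauss p)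
  have hcomp : ∫ x, V x ∂(gauss q) = ∫ x, V (q.mean + act (1 + B) (x - p.mean)) ∂(gauss p) := by
    rw [hmap]
    exact integral_map haff hV.continuous.aestronglyMeasurable
  have hlog : Real.log (partition q) ≤ Real.log (partition p) + B.trace := by
    rw [partition_eq_abs_det_mul p q h', abs_of_pos hA.det_pos,
      Real.log_mul hA.det_pos.ne' (partition_pos p).ne']
    have := log_det_le_trace_sub hA
    rw [Matrix.trace_add, Matrix.trace_one, Fintype.card_fin] at this
    linarith
  have hpt : ∀ x, V x + (inner ℝ (gradient V x) δ + inner ℝ (gradient V x) (act B (x - p.mean))) +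
      lam / 2 * (‖δ‖ ^ 2 + 2 * inner ℝ (x - p.mean) (act B.transpose δ) +
        inner ℝ (x - p.mean) (act (B.transpose * B) (x - p.mean))) ≤
      V (q.mean + act (1 + B) (x - p.mean)) := fun x => by
    have h1 := add_inner_add_sq_le (hV.differentiable two_ne_zero) hconv x
      (q.mean + act (1 + B) (x - p.mean))
    have h2 : q.mean + act (1 + B) (x - p.mean) - x = δ + act B (x - p.mean) := by
      rw [add_act, act_one]; simp only [δ]; abel
    rw [h2, inner_add_right, norm_add_sq_real] at h1
    rw [act_mul, ← inner_act_left, ← inner_act_left, real_inner_self_eq_norm_sq,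
      real_inner_comm δ (act B _)]
    linarith
  have i1 := hVi.integrable_gauss p
  have i2 := (gaussIntegrable_inner_left hg δ).integrable_gauss p
  have i3 := integrable_gradient_inner_act hg p B
  have i4 : Integrable (fun x => 2 * inner ℝ (x - p.mean) (act B.transpose δ)) (gauss p) :=
    ((gaussIntegrable_inner _ _).integrable_gauss p).const_mul 2
  have i5 := integrable_inner_act p (B.transpose * B)
  have i45 : Integrable (fun x => ‖δ‖ ^ 2 + 2 * inner ℝ (x - p.mean) (act B.transpose δ))
    (gauss p) := (integrable_const _).add i4
  have i6 : Integrable (fun x => lam / 2 * (‖δ‖ ^ 2 +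
      2 * inner ℝ (x - p.mean) (act B.transpose δ) +
        inner ℝ (x - p.mean) (act (B.transpose * B) (x - p.mean)))) (gauss p) :=
    (i45.add i5).const_mul _
  have i23 : Integrable (fun x => inner ℝ (gradient V x) δ +
      inner ℝ (gradient V x) (act B (x - p.mean))) (gauss p) := i2.add i3
  have i123 : Integrable (fun x => V x + (inner ℝ (gradient V x) δ +
      inner ℝ (gradient V x) (act B (x - p.mean)))) (gauss p) := i1.add i23
  have i7 : Integrable (fun x => V (q.mean + act (1 + B) (x - p.mean))) (gauss p) := by
    have := hVi.integrable_gauss q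
    rw [hmap, integrable_map_measure hV.continuous.aestronglyMeasurable haff] at this
    exact this
  have hint := integral_mono (i123.add i6) i7 hpt
  simp only [Pi.add_apply] at hint
  rw [integral_add i123 i6, integral_add i1 i23, integral_add i2 i3, integral_const_mul,
    integral_add i45 i5, integral_add (integrable_const _) i4, integral_const_mul,
    integral_inner_gauss, integral_inner_act_gauss, integral_gradient_inner_act hV hg hH,
    ← hcomp] at hint
  simp only [inner_gradient, integral_fderiv_gauss hg] at hint
  simp only [integral_const, probReal_univ, one_smul] at hint
  rw [realEnergy, realEnergy]
  linarith

theorem trace_mul_mul_transpose_nonneg (p : Param d) (M : Matrix (Fin d) (Fin d) ℝ) :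
    0 ≤ (M * p.cov * M.transpose).trace := by
  simpa using (p.posDef.posSemidef.mul_mul_conjTranspose_same M).trace_nonneg

/-- The dissipation of the energy under the Otto part `2 (S Σ + Σ S)`, `μ` of the Onsager operator,
where `(S, μ) = DE(p)`. -/
noncomputable def ottoDissipation (V : EuclideanSpace ℝ (Fin d) → ℝ) (p : Param d) : ℝ :=
  4 * ((dEnergy V p).1 * p.cov * (dEnergy V p).1).trace + ‖(dEnergy V p).2‖ ^ 2

theorem transpose_dEnergy_fst (hV : ContDiff ℝ 2 V) (p : Param d) :
    (dEnergy V p).1.transpose = (dEnergy V p).1 := by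
  rw [dEnergy, Matrix.transpose_smul, Matrix.transpose_sub, p.transpose_inv,
    transpose_meanHess hV]

/-- The Polyak-Łojasiewicz inequality for the Otto part: complete the squares in the displacement
convexity inequality. -/
theorem two_mul_sub_le_ottoDissipation {lam : ℝ} (hlam : 0 < lam) (hV : ContDiff ℝ 2 V)
    (hconv : ConvexOn ℝ Set.univ (fun x => V x - lam / 2 * ‖x‖ ^ 2))
    (hVi : GaussIntegrable V) (hg : GaussIntegrable (gradient V))
    (hH : ∀ i j, GaussIntegrable fun x => hess V x i j) (p q : Param d) :
    2 * lam * (realEnergy V p - realEnergy V q) ≤ ottoDissipation V p := by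
  -- `1 + B` is the optimal transport, so that `B` is the displacement of the centred part
  obtain ⟨A, hA, hAq⟩ := exists_posDef_mul_mul_eq p.posDef q.posDef
  obtain ⟨B, rfl⟩ : ∃ B, A = 1 + B := ⟨A - 1, by abel⟩
  have h := realEnergy_add_le hV hconv hVi hg hH p q hA hAq
  set S := (dEnergy V p).1 with hSdef
  set g := (dEnergy V p).2 with hgdef
  set δ := q.mean - p.mean
  have hST : S.transpose = S := transpose_dEnergy_fst hV p
  have hg' : meanGrad V p = g := rfl
  have hlin : (B * p.cov * meanHess V p).trace - B.trace = 2 * (B * p.cov * S).trace := by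
    have : B * p.cov * S = (1 / 2 : ℝ) • (B * p.cov * meanHess V p - B) := by
      rw [hSdef, dEnergy, Matrix.mul_smul, Matrix.mul_sub, Matrix.mul_assoc B p.cov p.cov⁻¹,
        p.cov_mul_inv, Matrix.mul_one]
    rw [this, Matrix.trace_smul, Matrix.trace_sub, smul_eq_mul]
    ring
  -- the square of `lam B + 2 S` in the weight `Σ`
  have hsq : 0 ≤ lam ^ 2 * (B.transpose * B * p.cov).trace + 4 * lam * (B * p.cov * S).trace +
      4 * (S * p.cov * S).trace := by
    have h0 := trace_mul_mul_transpose_nonneg p (lam • B + (2 : ℝ) • S)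
    have h1 : (B * p.cov * B.transpose).trace = (B.transpose * B * p.cov).trace :=
      Matrix.trace_mul_cycle _ _ _
    have h2 : (S * p.cov * B.transpose).trace = (B * p.cov * S).trace := by
      rw [← Matrix.trace_transpose, Matrix.transpose_mul, Matrix.transpose_mul,
        Matrix.transpose_transpose, p.transpose_cov, hST, Matrix.mul_assoc]
    simp only [Matrix.transpose_add, Matrix.transpose_smul, hST, Matrix.add_mul, Matrix.mul_add,
      Matrix.smul_mul, Matrix.mul_smul, Matrix.trace_add, Matrix.trace_smul, smul_eq_mul, h1,
      h2] at h0
    nlinarith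
  have hvec : 0 ≤ lam ^ 2 * ‖δ‖ ^ 2 + 2 * lam * inner ℝ g δ + ‖g‖ ^ 2 := by
    have h0 := sq_nonneg ‖lam • δ + g‖
    rw [norm_add_sq_real, norm_smul, inner_smul_left, real_inner_comm, mul_pow,
      Real.norm_eq_abs, sq_abs] at h0
    simp only [conj_trivial] at h0
    linarith
  rw [hg'] at h
  rw [ottoDissipation]
  have h3 := mul_le_mul_of_nonneg_left h (show 0 ≤ 2 * lam by positivity)
  nlinarith

/-! ### Differentiation of Gaussian averages -/

/-- Exponential families can be differentiated under the integral sign: near `θ₀` the derivative of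
the integrand is dominated by a fixed Gaussian weight, since the statistic `ψ` has at most quadratic
growth. -/
theorem hasFDerivAt_integral_exp_neg {Θ : Type*} [NormedAddCommGroup Θ] [NormedSpace ℝ Θ]
    {ψ : EuclideanSpace ℝ (Fin d) → Θ →L[ℝ] ℝ} (hψ : Continuous ψ) {K : ℝ}
    (hK : ∀ x, ‖ψ x‖ ≤ K * (1 + ‖x‖ ^ 2)) {θ₀ : Θ} {c C : ℝ} (hc : 0 < c)
    (hθ₀ : ∀ x, c * ‖x‖ ^ 2 - C ≤ ψ x θ₀) {f : EuclideanSpace ℝ (Fin d) → ℝ}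
    (hf : GaussIntegrable f) :
    Integrable (fun x => (Real.exp (-ψ x θ₀) * f x) • -ψ x) ∧
    HasFDerivAt (fun θ => ∫ x, Real.exp (-ψ x θ) * f x)
      (∫ x, (Real.exp (-ψ x θ₀) * f x) • -ψ x) θ₀ := by
  have hK0 : 0 ≤ K := by simpa using (norm_nonneg _).trans (hK 0)
  have hfm := hf.aestronglyMeasurable
  -- a radius on which the quadratic lower bound of the exponent survives with half the constant
  set ε : ℝ := c / (2 * (K + 1))
  have hε : 0 < ε := by positivity
  have hKε : K * ε ≤ c / 2 := by
    simp only [ε]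
    rw [mul_div_assoc', div_le_div_iff₀ (by positivity) two_pos]
    nlinarith
  have hball : ∀ θ ∈ Metric.ball θ₀ ε, ∀ x, c / 2 * ‖x‖ ^ 2 - (C + c / 2) ≤ ψ x θ := by
    intro θ hθ x
    have h1 : |ψ x (θ - θ₀)| ≤ c / 2 * (1 + ‖x‖ ^ 2) := by
      calc |ψ x (θ - θ₀)| ≤ ‖ψ x‖ * ‖θ - θ₀‖ := (ψ x).le_opNorm _
        _ ≤ K * (1 + ‖x‖ ^ 2) * ε := by
            gcongr
            · exact hK x
            · exact (mem_ball_iff_norm.1 hθ).le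
        _ = K * ε * (1 + ‖x‖ ^ 2) := by ring
        _ ≤ _ := by gcongr
    rw [map_sub] at h1
    linarith [(abs_le.1 h1).1, hθ₀ x]
  have hfK : GaussIntegrable fun x => K * (1 + ‖x‖ ^ 2) * f x := by
    refine hf.of_norm_le ((by fun_prop : AEStronglyMeasurable
      (fun x : EuclideanSpace ℝ (Fin d) => K * (1 + ‖x‖ ^ 2)) volume).mul hfm) K fun x => ?_
    rw [norm_mul, Real.norm_of_nonneg (by positivity : 0 ≤ K * (1 + ‖x‖ ^ 2))]
  have hbi : Integrable fun x => Real.exp (C + c / 2) *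
      ‖Real.exp (-(c / 2) * ‖x‖ ^ 2) • (K * (1 + ‖x‖ ^ 2) * f x)‖ :=
    (hfK (c / 2) (by positivity)).norm.const_mul _
  have hbound : ∀ x, ∀ θ ∈ Metric.ball θ₀ ε, ‖(Real.exp (-ψ x θ) * f x) • -ψ x‖ ≤
      Real.exp (C + c / 2) *
        ‖Real.exp (-(c / 2) * ‖x‖ ^ 2) • (K * (1 + ‖x‖ ^ 2) * f x)‖ := by
    intro x θ hθ
    rw [norm_smul, norm_mul, norm_neg, norm_smul, norm_mul,
      Real.norm_of_nonneg (by positivity : 0 ≤ K * (1 + ‖x‖ ^ 2)),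
      Real.norm_of_nonneg (Real.exp_pos _).le, Real.norm_of_nonneg (Real.exp_pos _).le,
      ← mul_assoc, ← Real.exp_add, mul_comm (K * (1 + ‖x‖ ^ 2)), ← mul_assoc]
    gcongr
    · linarith [hball θ hθ x]
    · exact hK x
  have hmeas : AEStronglyMeasurable (fun x => (Real.exp (-ψ x θ₀) * f x) • -ψ x) volume :=
    ((by fun_prop : AEStronglyMeasurable (fun x => Real.exp (-ψ x θ₀)) volume).mul hfm).smul
      hψ.neg.aestronglyMeasurable
  refine ⟨hbi.mono' hmeas (Filter.Eventually.of_forall fun x =>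
    hbound x θ₀ (Metric.mem_ball_self hε)), ?_⟩
  refine hasFDerivAt_integral_of_dominated_of_fderiv_le (Metric.ball_mem_nhds θ₀ hε)
    (Filter.Eventually.of_forall fun θ =>
      (by fun_prop : AEStronglyMeasurable (fun x => Real.exp (-ψ x θ)) volume).mul hfm)
    (hf.integrable_exp_smul (by fun_prop) hc hθ₀) hmeas
    (Filter.Eventually.of_forall hbound) hbi (Filter.Eventually.of_forall fun x θ _ => ?_)
  refine (((ψ x).hasFDerivAt (x := θ)).neg.exp.mul_const (f x)).congr_fderiv ?_
  rw [smul_smul, mul_comm]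
  rfl

section
variable {E : Type*} [NormedAddCommGroup E] [InnerProductSpace ℝ E]

/-- The sufficient statistic of the Gaussian family as a function of the natural parameter: the
precision operator `P`, the vector `b = P m` and the constant `a = m · P m / 2`. -/
noncomputable def gaussStat (x : E) :
    ((E →L[ℝ] E) × E × ℝ)
      →L[ℝ] ℝ :=
  (1 / 2 : ℝ) • (innerSL ℝ x).comp ((ContinuousLinearMap.apply ℝ (E) x).comp
      (ContinuousLinearMap.fst ℝ _ _)) -
    (innerSL ℝ x).comp ((ContinuousLinearMap.fst ℝ _ _).comp (ContinuousLinearMap.snd ℝ _ _)) +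
    (ContinuousLinearMap.snd ℝ _ _).comp (ContinuousLinearMap.snd ℝ _ _)

theorem gaussStat_apply (x : E)
    (P : E →L[ℝ] E)
    (b : E) (a : ℝ) :
    gaussStat x (P, b, a) = 1 / 2 * inner ℝ x (P x) - inner ℝ x b + a := by
  simp [gaussStat]

theorem continuous_gaussStat : Continuous (gaussStat (E := E)) := by
  have h1 : Continuous fun x : E => innerSL ℝ x := (innerSL ℝ).continuous
  have h2 : Continuous fun x : E =>
      ContinuousLinearMap.apply ℝ (E) x :=
    (ContinuousLinearMap.apply ℝ (E)).continuous
  have h3 : Continuous fun x : E => (innerSL ℝ x).comp ((ContinuousLinearMap.apply ℝ E x).comp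
      (ContinuousLinearMap.fst ℝ (E →L[ℝ] E) (E × ℝ))) :=
    h1.clm_comp (h2.clm_comp continuous_const)
  have h4 : Continuous fun x : E => (innerSL ℝ x).comp ((ContinuousLinearMap.fst ℝ E ℝ).comp
      (ContinuousLinearMap.snd ℝ (E →L[ℝ] E) (E × ℝ))) := h1.clm_comp continuous_const
  unfold gaussStat
  exact ((h3.const_smul (1 / 2 : ℝ)).sub h4).add continuous_const

theorem norm_gaussStat_le (x : E) :
    ‖gaussStat x‖ ≤ 2 * (1 + ‖x‖ ^ 2) := by
  refine ContinuousLinearMap.opNorm_le_bound _ (by positivity) fun ⟨P, b, a⟩ => ?_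
  rw [gaussStat_apply]
  set N := ‖(P, b, a)‖
  have hN : 0 ≤ N := norm_nonneg _
  have hP : ‖P‖ ≤ N := norm_fst_le (P, b, a)
  have hb : ‖b‖ ≤ N := (norm_fst_le (b, a)).trans (norm_snd_le (P, b, a))
  have ha : ‖a‖ ≤ N := (norm_snd_le (b, a)).trans (norm_snd_le (P, b, a))
  have h1 : |inner ℝ x (P x)| ≤ N * ‖x‖ ^ 2 := by
    calc |inner ℝ x (P x)| ≤ ‖x‖ * ‖P x‖ := abs_real_inner_le_norm _ _
      _ ≤ ‖x‖ * (N * ‖x‖) := by gcongr; exact P.le_of_opNorm_le hP x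
      _ = _ := by ring
  have h2 : |inner ℝ x b| ≤ ‖x‖ * N := (abs_real_inner_le_norm _ _).trans (by gcongr)
  have h3 : ‖x‖ * N ≤ 1 / 2 * (1 + ‖x‖ ^ 2) * N := by
    gcongr
    nlinarith [sq_nonneg (‖x‖ - 1)]
  rw [Real.norm_eq_abs] at ha
  have h4 : 0 ≤ ‖x‖ ^ 2 * N := by positivity
  rw [Real.norm_eq_abs, abs_le]
  constructor <;> linarith [(abs_le.1 h1).1, (abs_le.1 h1).2, (abs_le.1 h2).1, (abs_le.1 h2).2,
    (abs_le.1 ha).1, (abs_le.1 ha).2]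

end

/-- The natural parameter of a Gaussian. -/
noncomputable def natParam (p : Param d) :
    (EuclideanSpace ℝ (Fin d) →L[ℝ] EuclideanSpace ℝ (Fin d)) × EuclideanSpace ℝ (Fin d) × ℝ :=
  (Matrix.toEuclideanCLM (𝕜 := ℝ) p.cov⁻¹, act p.cov⁻¹ p.mean,
    1 / 2 * inner ℝ p.mean (act p.cov⁻¹ p.mean))

theorem inner_act_inv_comm (p : Param d) (x y : EuclideanSpace ℝ (Fin d)) :
    inner ℝ (act p.cov⁻¹ x) y = inner ℝ x (act p.cov⁻¹ y) := by
  rw [inner_act_left, p.transpose_inv]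

theorem gaussStat_natParam (p : Param d) (x : EuclideanSpace ℝ (Fin d)) :
    gaussStat x (natParam p) = quad p x := by
  rw [natParam, gaussStat_apply, ← act_eq_toEuclideanCLM, quad, act_sub, inner_sub_left,
    inner_sub_right, inner_sub_right, ← inner_act_inv_comm p p.mean x,
    real_inner_comm _ (act p.cov⁻¹ p.mean)]
  ring

section
variable {J : Set ℝ} {t : ℝ} {p : ℝ → Param d} {M : Matrix (Fin d) (Fin d) ℝ}
  {v : EuclideanSpace ℝ (Fin d)}

theorem hasDerivWithinAt_toEuclideanCLM_cov
    (hM : ∀ i j, HasDerivWithinAt (fun s => (p s).cov i j) (M i j) J t) :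
    HasDerivWithinAt (fun s => Matrix.toEuclideanCLM (𝕜 := ℝ) (p s).cov)
      (Matrix.toEuclideanCLM (𝕜 := ℝ) M) J t := by
  have h : ∀ A : Matrix (Fin d) (Fin d) ℝ, Matrix.toEuclideanCLM (𝕜 := ℝ) A =
      ∑ i, ∑ j, A i j • Matrix.toEuclideanCLM (𝕜 := ℝ) (Matrix.single i j (1 : ℝ)) := fun A => by
    conv_lhs => rw [Matrix.matrix_eq_sum_single A]
    simp only [map_sum]
    refine Finset.sum_congr rfl fun i _ => Finset.sum_congr rfl fun j _ => ?_
    rw [← map_smul, Matrix.smul_single, smul_eq_mul, mul_one]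
  rw [h M]
  simp only [fun s => h (p s).cov]
  exact HasDerivWithinAt.fun_sum fun i _ => HasDerivWithinAt.fun_sum fun j _ =>
    (hM i j).smul_const (F := EuclideanSpace ℝ (Fin d) →L[ℝ] EuclideanSpace ℝ (Fin d)) _

theorem hasDerivWithinAt_of_mul_eq_one {R : Type*} [NormedRing R] [CompleteSpace R]
    [NormedAlgebra ℝ R] {S P : ℝ → R} (h₁ : ∀ s, S s * P s = 1) (h₂ : ∀ s, P s * S s = 1) {S' : R}
    (hS : HasDerivWithinAt S S' J t) : HasDerivWithinAt P (-(P t * S' * P t)) J t := by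
  let u : ℝ → Rˣ := fun s => ⟨S s, P s, h₁ s, h₂ s⟩
  have h := (hasFDerivAt_ringInverse (𝕜 := ℝ) (u t)).comp_hasDerivWithinAt t hS
  have hinv : ∀ s, P s = Ring.inverse (S s) := fun s => (Ring.inverse_unit (u s)).symm
  refine (h.congr_deriv ?_).congr (fun s _ => hinv s) (hinv t)
  simp [u]

theorem hasDerivWithinAt_toEuclideanCLM_inv
    (hM : ∀ i j, HasDerivWithinAt (fun s => (p s).cov i j) (M i j) J t) :
    HasDerivWithinAt (fun s => Matrix.toEuclideanCLM (𝕜 := ℝ) (p s).cov⁻¹)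
      (-Matrix.toEuclideanCLM (𝕜 := ℝ) ((p t).cov⁻¹ * M * (p t).cov⁻¹)) J t := by
  rw [map_mul, map_mul]
  exact hasDerivWithinAt_of_mul_eq_one
    (fun s => by rw [← map_mul, (p s).cov_mul_inv, map_one])
    (fun s => by rw [← map_mul, (p s).inv_mul_cov, map_one])
    (hasDerivWithinAt_toEuclideanCLM_cov hM)

theorem hasDerivWithinAt_natParam
    (hM : ∀ i j, HasDerivWithinAt (fun s => (p s).cov i j) (M i j) J t)
    (hv : HasDerivWithinAt (fun s => (p s).mean) v J t) :
    HasDerivWithinAt (fun s => natParam (p s))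
      (-Matrix.toEuclideanCLM (𝕜 := ℝ) ((p t).cov⁻¹ * M * (p t).cov⁻¹),
        -act ((p t).cov⁻¹ * M * (p t).cov⁻¹) (p t).mean + act (p t).cov⁻¹ v,
        1 / 2 * (inner ℝ (p t).mean
            (-act ((p t).cov⁻¹ * M * (p t).cov⁻¹) (p t).mean + act (p t).cov⁻¹ v) +
          inner ℝ v (act (p t).cov⁻¹ (p t).mean))) J t := by
  have hP := hasDerivWithinAt_toEuclideanCLM_inv hM
  have hb := hP.clm_apply hv
  exact hP.prodMk (hb.prodMk ((hv.inner ℝ hb).const_mul (1 / 2)))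

/-- The derivative of an unnormalized Gaussian average along a curve of parameters. -/
theorem hasDerivWithinAt_integral_exp_neg_quad
    (hM : ∀ i j, HasDerivWithinAt (fun s => (p s).cov i j) (M i j) J t)
    (hMT : M.transpose = M) (hv : HasDerivWithinAt (fun s => (p s).mean) v J t)
    {f : EuclideanSpace ℝ (Fin d) → ℝ} (hf : GaussIntegrable f) :
    HasDerivWithinAt (fun s => ∫ x, Real.exp (-quad (p s) x) * f x)
      (∫ x, Real.exp (-quad (p t) x) * (f x *
        (1 / 2 * inner ℝ (act (p t).cov⁻¹ (x - (p t).mean))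
          (act M (act (p t).cov⁻¹ (x - (p t).mean))) +
          inner ℝ (x - (p t).mean) (act (p t).cov⁻¹ v)))) J t := by
  obtain ⟨c, C, hc, hlow⟩ := exists_le_quad (p t)
  obtain ⟨hi, h⟩ := hasFDerivAt_integral_exp_neg continuous_gaussStat norm_gaussStat_le
    (θ₀ := natParam (p t)) hc (fun x => by rw [gaussStat_natParam]; exact hlow x) hf
  have h1 := h.comp_hasDerivWithinAt t (hasDerivWithinAt_natParam hM hv)
  rw [ContinuousLinearMap.integral_apply hi] at h1
  simp only [Function.comp_def, gaussStat_natParam] at h1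
  refine h1.congr_deriv (integral_congr_ae (Filter.Eventually.of_forall fun x => ?_))
  simp only [_root_.smul_apply, _root_.neg_apply, gaussStat_apply,
    smul_eq_mul, ← act_eq_toEuclideanCLM, mul_assoc]
  congr 2
  have hsym : ∀ y z, inner ℝ y (act M z) = inner ℝ z (act M y) := fun y z => by
    rw [real_inner_comm, inner_act_left, hMT]
  set P := (p t).cov⁻¹
  set m := (p t).mean
  have hP : ∀ y z, inner ℝ (act P y) z = inner ℝ y (act P z) := inner_act_inv_comm (p t)
  have hcomm : ∀ y z, inner ℝ y (act P (act M (act P z))) = inner ℝ (act P y) (act M (act P z)) :=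
    fun y z => (hP _ _).symm
  simp only [act_mul, inner_sub_left, inner_sub_right, inner_add_right, inner_neg_right, act_sub,
    hcomm, hsym (act P m) (act P x)]
  have h3 : inner ℝ v (act P m) = inner ℝ m (act P v) := by rw [real_inner_comm, hP]
  rw [h3, hsym (act P x) (act P m)]
  linarith

theorem integral_exp_neg_quad_mul (q : Param d) (f : EuclideanSpace ℝ (Fin d) → ℝ) :
    ∫ x, Real.exp (-quad q x) * f x = partition q * ∫ x, f x ∂(gauss q) := by
  rw [integral_gauss, ← integral_const_mul]
  refine integral_congr_ae (Filter.Eventually.of_forall fun x => ?_)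
  have := (partition_pos q).ne'
  simp only [gaussDensity_eq, smul_eq_mul]
  field_simp

/-- The first variation of a Gaussian average, by integrating by parts twice. -/
theorem integral_mul_variation (hV : ContDiff ℝ 2 V) (hVi : GaussIntegrable V)
    (hg : GaussIntegrable (gradient V)) (hH : ∀ i j, GaussIntegrable fun x => hess V x i j)
    (q : Param d) (M : Matrix (Fin d) (Fin d) ℝ) (v : EuclideanSpace ℝ (Fin d)) :
    ∫ x, V x * (1 / 2 * inner ℝ (act q.cov⁻¹ (x - q.mean)) (act M (act q.cov⁻¹ (x - q.mean))) +
          inner ℝ (x - q.mean) (act q.cov⁻¹ v)) ∂(gauss q) =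
      1 / 2 * (M * (meanHess V q + (∫ x, V x ∂(gauss q)) • q.cov⁻¹)).trace +
        inner ℝ (meanGrad V q) v := by
  have hd := hV.differentiable two_ne_zero
  let e : Fin d → EuclideanSpace ℝ (Fin d) := fun i => EuclideanSpace.single i 1
  have hcov : ∀ w, act q.cov (act q.cov⁻¹ w) = w := fun w => by
    rw [← act_mul, q.cov_mul_inv, act_one]
  have hlin : ∫ x, V x * inner ℝ (x - q.mean) (act q.cov⁻¹ v) ∂(gauss q) =
      inner ℝ (meanGrad V q) v := by
    rw [integral_mul_inner_gauss q hd hVi _ (gaussIntegrable_fderiv hg _), hcov,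
      integral_fderiv_gauss hg]
  have hprod : ∀ i, Differentiable ℝ fun x => V x * inner ℝ (x - q.mean) (act q.cov⁻¹ (e i)) :=
    fun i => hd.mul (differentiable_inner_sub _ _)
  have hder : ∀ i j x, fderiv ℝ (fun x => V x * inner ℝ (x - q.mean) (act q.cov⁻¹ (e i))) x
      (act q.cov (act q.cov⁻¹ (e j))) =
      V x * q.cov⁻¹ j i + fderiv ℝ V x (e j) * inner ℝ (x - q.mean) (act q.cov⁻¹ (e i)) :=
    fun i j x => by
      rw [hcov, fderiv_fun_mul (hd x) (differentiable_inner_sub _ _ x)]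
      simp only [_root_.add_apply, _root_.smul_apply, smul_eq_mul,
        fderiv_inner_sub, e, inner_single_act_single]
      ring
  have i1 : ∀ a, GaussIntegrable fun x => V x * a := fun a c hc => by
    simpa only [smul_eq_mul, mul_assoc] using (hVi c hc).mul_const a
  have i2 : ∀ i j, GaussIntegrable fun x =>
      fderiv ℝ V x (e j) * inner ℝ (x - q.mean) (act q.cov⁻¹ (e i)) := fun i j =>
    (gaussIntegrable_fderiv hg _).mul_inner _ _
  have hquad : ∀ i j, ∫ x, V x * inner ℝ (x - q.mean) (act q.cov⁻¹ (e i)) *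
      inner ℝ (x - q.mean) (act q.cov⁻¹ (e j)) ∂(gauss q) =
      (∫ x, V x ∂(gauss q)) * q.cov⁻¹ j i + meanHess V q i j := fun i j => by
    rw [integral_mul_inner_gauss q (hprod i) (hVi.mul_inner _ _) _
      (by simp only [hder]; exact (i1 _).add (i2 i j))]
    simp only [hder]
    rw [integral_add ((i1 _).integrable_gauss q) ((i2 i j).integrable_gauss q),
      integral_mul_const, integral_fderiv_mul_inner_gauss hV hg hH, hcov]
    simp [e]
  have i3 : ∀ i j, Integrable (fun x => M i j * (V x * inner ℝ (x - q.mean) (act q.cov⁻¹ (e i)) *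
      inner ℝ (x - q.mean) (act q.cov⁻¹ (e j)))) (gauss q) := fun i j =>
    (((hVi.mul_inner _ _).mul_inner _ _).integrable_gauss q).const_mul _
  have hexp : ∀ x, V x * (1 / 2 * inner ℝ (act q.cov⁻¹ (x - q.mean))
      (act M (act q.cov⁻¹ (x - q.mean))) + inner ℝ (x - q.mean) (act q.cov⁻¹ v)) =
      1 / 2 * (∑ i, ∑ j, M i j * (V x * inner ℝ (x - q.mean) (act q.cov⁻¹ (e i)) *
        inner ℝ (x - q.mean) (act q.cov⁻¹ (e j)))) +
        V x * inner ℝ (x - q.mean) (act q.cov⁻¹ v) := fun x => by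
    rw [inner_act_act_eq_sum M _ q.transpose_inv, mul_add, mul_left_comm, Finset.mul_sum]
    congr 2
    refine Finset.sum_congr rfl fun i _ => ?_
    rw [Finset.mul_sum]
    exact Finset.sum_congr rfl fun j _ => by ring
  rw [integral_congr_ae (Filter.Eventually.of_forall hexp), integral_add
      ((integrable_finsetSum _ fun i _ => integrable_finsetSum _ fun j _ => i3 i j).const_mul _)
      ((hVi.mul_inner _ _).integrable_gauss q), hlin, integral_const_mul,
    integral_finsetSum _ fun i _ => integrable_finsetSum _ fun j _ => i3 i j]
  congr 2
  simp only [Matrix.trace, Matrix.diag, Matrix.mul_apply]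
  refine Finset.sum_congr rfl fun i _ => ?_
  rw [integral_finsetSum _ fun j _ => i3 i j]
  refine Finset.sum_congr rfl fun j _ => ?_
  rw [integral_const_mul, hquad]
  have h4 : meanHess V q i j = meanHess V q j i := by
    nth_rewrite 1 [← transpose_meanHess hV]; rfl
  rw [h4]
  simp [add_comm]

/-- The chain rule for the energy along a curve of Gaussians. The derivative of the normalizing
constant is the case `V = 1` of the derivative of the unnormalized average. -/
theorem hasDerivWithinAt_realEnergy (hV : ContDiff ℝ 2 V) (hVi : GaussIntegrable V)
    (hg : GaussIntegrable (gradient V)) (hH : ∀ i j, GaussIntegrable fun x => hess V x i j)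
    (hM : ∀ i j, HasDerivWithinAt (fun s => (p s).cov i j) (M i j) J t)
    (hMT : M.transpose = M) (hv : HasDerivWithinAt (fun s => (p s).mean) v J t) :
    HasDerivWithinAt (fun s => realEnergy V (p s))
      ((M * (dEnergy V (p t)).1).trace + inner ℝ (dEnergy V (p t)).2 v) J t := by
  have hN := hasDerivWithinAt_integral_exp_neg_quad hM hMT hv hVi
  have hZ := hasDerivWithinAt_integral_exp_neg_quad hM hMT hv (gaussIntegrable_const (1 : ℝ))
  have hgrad : gradient (fun _ : EuclideanSpace ℝ (Fin d) => (1 : ℝ)) = 0 := by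
    ext1 x; simp [gradient]
  have hhess : ∀ x, hess (fun _ : EuclideanSpace ℝ (Fin d) => (1 : ℝ)) x = 0 := fun x => by
    ext i j; simp [hess]
  have h1 := integral_mul_variation (V := fun _ => 1) contDiff_const (gaussIntegrable_const 1)
    (by rw [hgrad]; exact gaussIntegrable_const 0)
    (fun i j => by simp only [hhess]; exact gaussIntegrable_const 0) (p t) M v
  have hmH : meanHess (fun _ : EuclideanSpace ℝ (Fin d) => (1 : ℝ)) (p t) = 0 := by
    ext i j; simp [meanHess, hhess]
  have hmg : meanGrad (fun _ : EuclideanSpace ℝ (Fin d) => (1 : ℝ)) (p t) = 0 := by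
    simp [meanGrad, hgrad]
  simp only [integral_exp_neg_quad_mul] at hN hZ
  rw [integral_mul_variation hV hVi hg hH] at hN
  rw [h1, hmH, hmg] at hZ
  simp only [integral_const, probReal_univ, smul_eq_mul, mul_one, one_smul, zero_add,
    inner_zero_left, add_zero] at hZ
  have hZt := (partition_pos (p t)).ne'
  have h2 := ((hN.div hZ hZt).sub_const ((d : ℝ) / 2)).sub (hZ.log hZt)
  refine (h2.congr_deriv ?_).congr (fun s _ => ?_) ?_
  · have h3 : (M * (dEnergy V (p t)).1).trace =
        1 / 2 * ((M * meanHess V (p t)).trace - (M * (p t).cov⁻¹).trace) := by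
      simp only [dEnergy, Matrix.mul_smul, Matrix.mul_sub, Matrix.trace_smul, Matrix.trace_sub,
        smul_eq_mul]
    rw [h3, Matrix.mul_add, Matrix.mul_smul, Matrix.trace_add, Matrix.trace_smul, smul_eq_mul]
    simp only [dEnergy]
    field_simp
    ring
  · have := (partition_pos (p s)).ne'
    simp [realEnergy, this]
  · simp [realEnergy, hZt]

end

/-! ### Dissipation along the gradient flow -/

open scoped MatrixOrder in
theorem posSemidef_sub_of_le_eigenvalues {A : Matrix (Fin d) (Fin d) ℝ} (hA : A.IsHermitian)
    {c : ℝ} (h : ∀ i, c ≤ hA.eigenvalues i) : (A - c • 1).PosSemidef := by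
  have h1 : algebraMap ℝ (Matrix (Fin d) (Fin d) ℝ) c ≤ A := by
    refine (algebraMap_le_iff_le_spectrum (R := ℝ) (a := A) hA).2 fun x hx => ?_
    rw [hA.spectrum_real_eq_range_eigenvalues] at hx
    obtain ⟨i, rfl⟩ := hx
    exact h i
  rw [Algebra.algebraMap_eq_smul_one] at h1
  exact Matrix.le_iff.1 h1

/-- The dissipation `⟨DE, K DE⟩` of the energy under the reduced Onsager operator. -/
noncomputable def dissipation (V : EuclideanSpace ℝ (Fin d) → ℝ) (α β : ℝ) (p : Param d) : ℝ :=
  α * ottoDissipation V p +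
    β * (2 * (p.cov * (dEnergy V p).1 * p.cov * (dEnergy V p).1).trace +
      inner ℝ (dEnergy V p).2 (act p.cov (dEnergy V p).2))

/-- If all eigenvalues of `Σ` are at least `c`, then the spherical Hellinger part of the Onsager
operator dominates `c / 2` times its Otto part. The factor `1 / 2` comes from the covariance, since
`2 tr (Σ S Σ S) ≥ 2 c tr (S Σ S)`, against `4 tr (S Σ S)` in the Otto part. -/
theorem mul_ottoDissipation_le_dissipation {α β c : ℝ} (hβ : 0 ≤ β) (hc : 0 ≤ c)
    (hV : ContDiff ℝ 2 V) {p : Param d} (h : ∀ i, c ≤ p.posDef.isHermitian.eigenvalues i) :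
    (α + β * (c / 2)) * ottoDissipation V p ≤ dissipation V α β p := by
  have hps := posSemidef_sub_of_le_eigenvalues p.posDef.isHermitian h
  set S := (dEnergy V p).1 with hS
  set g := (dEnergy V p).2 with hg
  have hST : S.transpose = S := transpose_dEnergy_fst hV p
  have htr : c * (S * p.cov * S).trace ≤ (p.cov * S * p.cov * S).trace := by
    obtain ⟨X, -, hX⟩ := exists_eq_transpose_mul_self p.posDef
    have h0 := (hps.mul_mul_conjTranspose_same (X * S)).trace_nonneg
    rw [Matrix.conjTranspose_eq_transpose_of_trivial, Matrix.trace_mul_comm,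
      Matrix.transpose_mul, hST] at h0
    have h1 : S * X.transpose * (X * S * (p.cov - c • 1)) =
        S * p.cov * S * p.cov - c • (S * p.cov * S) := by
      have : S * X.transpose * (X * S * (p.cov - c • 1)) =
          S * (X.transpose * X) * S * (p.cov - c • 1) := by simp only [Matrix.mul_assoc]
      rw [this, ← hX, Matrix.mul_sub, Matrix.mul_smul, Matrix.mul_one]
    rw [h1, Matrix.trace_sub, Matrix.trace_smul, smul_eq_mul] at h0
    have h2 : (p.cov * S * p.cov * S).trace = (S * p.cov * S * p.cov).trace := by
      rw [Matrix.mul_assoc, Matrix.mul_assoc, Matrix.trace_mul_comm]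
      simp only [Matrix.mul_assoc]
    linarith
  have hvec : c * ‖g‖ ^ 2 ≤ inner ℝ g (act p.cov g) := by
    have h0 := hps.dotProduct_mulVec_nonneg g.ofLp
    have h1 : star g.ofLp ⬝ᵥ (p.cov - c • 1).mulVec g.ofLp =
        inner ℝ g (act (p.cov - c • 1) g) := by
      simp [PiLp.inner_apply, act, dotProduct, mul_comm]
    rw [h1, sub_act, smul_act, act_one, inner_sub_right, inner_smul_right,
      real_inner_self_eq_norm_sq] at h0
    linarith
  have hn : 0 ≤ c * ‖g‖ ^ 2 := by positivity
  rw [dissipation, ← hS, ← hg, add_mul, mul_assoc β]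
  have h3 : ottoDissipation V p = 4 * (S * p.cov * S).trace + ‖g‖ ^ 2 := rfl
  gcongr
  rw [h3]
  linarith

theorem ottoDissipation_nonneg (hV : ContDiff ℝ 2 V) (p : Param d) :
    0 ≤ ottoDissipation V p := by
  have h := trace_mul_mul_transpose_nonneg p (dEnergy V p).1
  rw [transpose_dEnergy_fst hV] at h
  rw [ottoDissipation]
  positivity

theorem dissipation_nonneg {α β : ℝ} (hα : 0 ≤ α) (hβ : 0 ≤ β) (hV : ContDiff ℝ 2 V)
    (p : Param d) : 0 ≤ dissipation V α β p := by
  have h := mul_ottoDissipation_le_dissipation (α := α) hβ le_rfl hV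
    (fun i => (p.posDef.eigenvalues_pos i).le)
  exact (mul_nonneg (by simpa using hα) (ottoDissipation_nonneg hV p)).trans h

/-- The energy-dissipation balance. -/
theorem IsGradientFlow.hasDerivWithinAt_realEnergy {α β : ℝ} {J : Set ℝ} {p : ℝ → Param d}
    (hp : IsGradientFlow V α β J p) (hV : ContDiff ℝ 2 V) (hVi : GaussIntegrable V)
    (hg : GaussIntegrable (gradient V)) (hH : ∀ i j, GaussIntegrable fun x => hess V x i j)
    {t : ℝ} (ht : t ∈ J) :
    HasDerivWithinAt (fun s => realEnergy V (p s)) (-dissipation V α β (p t)) J t := by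
  obtain ⟨h1, h2⟩ := hp t ht
  have hST := transpose_dEnergy_fst hV (p t)
  have h3 := GaussHK.hasDerivWithinAt_realEnergy hV hVi hg hH
    (M := -(onsager α β (p t) (dEnergy V (p t))).1) h1 (by
      simp [onsager, hST, (p t).transpose_cov, Matrix.mul_assoc, add_comm]) h2
  refine h3.congr_deriv ?_
  rw [dissipation, ottoDissipation]
  simp only [onsager]
  set S := (dEnergy V (p t)).1
  set g := (dEnergy V (p t)).2
  set C := (p t).cov
  have h4 : (C * S * S).trace = (S * C * S).trace := by
    rw [Matrix.mul_assoc, Matrix.trace_mul_comm, Matrix.mul_assoc, Matrix.trace_mul_comm]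
  simp only [Matrix.neg_mul, Matrix.trace_neg, Matrix.add_mul, Matrix.smul_mul, Matrix.trace_add,
    Matrix.trace_smul, smul_eq_mul, h4, inner_neg_right, inner_add_right, inner_smul_right,
    real_inner_self_eq_norm_sq]
  ring

/-- Gronwall's inequality for a function whose excess over `b` decays at rate `γ`. -/
theorem le_of_hasDerivWithinAt_le {e e' : ℝ → ℝ} {γ b T : ℝ} (hT : 0 ≤ T)
    (he : ∀ t ∈ Set.Icc 0 T, HasDerivWithinAt e (e' t) (Set.Icc 0 T) t)
    (h : ∀ t ∈ Set.Icc 0 T, e' t ≤ -(γ * (e t - b))) :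
    e T ≤ Real.exp (-(γ * T)) * e 0 + (1 - Real.exp (-(γ * T))) * b := by
  have hd : ∀ t ∈ Set.Icc 0 T, HasDerivWithinAt (fun s => Real.exp (γ * s) * (e s - b))
      (Real.exp (γ * t) * γ * (e t - b) + Real.exp (γ * t) * e' t) (Set.Icc 0 T) t := by
    intro t ht
    have h1 : HasDerivWithinAt (fun s => Real.exp (γ * s)) (Real.exp (γ * t) * γ)
        (Set.Icc 0 T) t := by
      simpa using (((hasDerivAt_id t).const_mul γ).exp).hasDerivWithinAt
    exact h1.mul ((he t ht).sub_const b)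
  have hanti := antitoneOn_of_hasDerivWithinAt_nonpos (convex_Icc 0 T)
    (fun t ht => (hd t ht).continuousWithinAt)
    (fun t ht => (hd t (interior_subset ht)).mono interior_subset) (fun t ht => by
      have := h t (interior_subset ht)
      have := Real.exp_pos (γ * t)
      nlinarith)
  have h2 := hanti (Set.left_mem_Icc.2 hT) (Set.right_mem_Icc.2 hT) hT
  simp only [mul_zero, Real.exp_zero, one_mul] at h2
  have h3 : Real.exp (-(γ * T)) * Real.exp (γ * T) = 1 := by rw [← Real.exp_add]; simp
  have h4 := mul_le_mul_of_nonneg_left h2 (Real.exp_pos (-(γ * T))).le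
  rw [← mul_assoc, h3, one_mul] at h4
  linarith

theorem realEnergy_le_of_isGradientFlow {lam α β r : ℝ} (hlam : 0 < lam) (hα : 0 ≤ α)
    (hβ : 0 ≤ β) (hV : ContDiff ℝ 2 V)
    (hconv : ConvexOn ℝ Set.univ (fun x => V x - lam / 2 * ‖x‖ ^ 2))
    [IsProbabilityMeasure (target V)]
    (hVi : GaussIntegrable V) (hg : GaussIntegrable (gradient V))
    (hH : ∀ i j, GaussIntegrable fun x => hess V x i j) {E : ENNReal} (hr : 0 < r)
    (hE : SublevelBound V E r) {J : Set ℝ} {p : ℝ → Param d} (hJ : J.OrdConnected)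
    (h0 : (0 : ℝ) ∈ J) (hp : IsGradientFlow V α β J p) (hp0 : energy V (p 0) ≤ E) {t : ℝ}
    (ht : t ∈ J) (ht0 : 0 ≤ t) (q : Param d) :
    realEnergy V (p t) ≤ Real.exp (-(rate lam α β r * t)) * realEnergy V (p 0) +
      (1 - Real.exp (-(rate lam α β r * t))) * realEnergy V q := by
  have hsub : Set.Icc 0 t ⊆ J := hJ.out h0 ht
  have hder : ∀ T ∈ Set.Icc 0 t, ∀ s ∈ Set.Icc 0 T, HasDerivWithinAt
      (fun s => realEnergy V (p s)) (-dissipation V α β (p s)) (Set.Icc 0 T) s :=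
    fun T hT s hs => (hp.hasDerivWithinAt_realEnergy hV hVi hg hH
      (hsub ⟨hs.1, hs.2.trans hT.2⟩)).mono ((Set.Icc_subset_Icc_right hT.2).trans hsub)
  refine le_of_hasDerivWithinAt_le ht0 (hder t ⟨ht0, le_rfl⟩) fun s hs => ?_
  -- the rate `0` shows that the flow stays in the sublevel of its starting point
  have hmono : realEnergy V (p s) ≤ realEnergy V (p 0) := by
    have := le_of_hasDerivWithinAt_le (γ := 0) (b := 0) hs.1 (hder s hs) fun τ _ => by
      simpa using dissipation_nonneg hα hβ hV (p τ)
    simpa using this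
  have hs' : energy V (p s) ≤ E := by
    rw [energy_eq_ofReal_realEnergy hV.continuous hVi] at hp0 ⊢
    exact (ENNReal.ofReal_le_ofReal hmono).trans hp0
  have h1 := mul_ottoDissipation_le_dissipation (α := α) hβ (inv_nonneg.2 hr.le) hV
    (fun i => ((hE (p s) hs').1 i).1)
  have h2 := two_mul_sub_le_ottoDissipation hlam hV hconv hVi hg hH (p s) q
  have h3 := mul_le_mul_of_nonneg_left h2 (show 0 ≤ α + β * (r⁻¹ / 2) by positivity)
  rw [rate]
  linarith

end GaussHK

theorem mainTheorem10 (d : ℕ) (V : EuclideanSpace ℝ (Fin d) → ℝ) (lam α β : ℝ)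
    (hlam : 0 < lam) (hα : 0 ≤ α) (hβ : 0 ≤ β)
    (hV : ContDiff ℝ 2 V)
    (hconv : ConvexOn ℝ Set.univ (fun x => V x - lam / 2 * ‖x‖ ^ 2))
    (hprob : IsProbabilityMeasure (GaussHK.target V))
    (hint : ∀ q : GaussHK.Param d, Integrable V (GaussHK.gauss q) ∧
      Integrable (gradient V) (GaussHK.gauss q) ∧
      ∀ i j, Integrable (fun x => GaussHK.hess V x i j) (GaussHK.gauss q)) :
    (∀ E : ENNReal, E ≠ ⊤ → ∃ r : ℝ, 0 < r ∧ GaussHK.SublevelBound V E r) ∧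
    ∀ (E : ENNReal) (r : ℝ), 0 < r → GaussHK.SublevelBound V E r →
      ∀ (J : Set ℝ) (p : ℝ → GaussHK.Param d),
        J.OrdConnected → (0 : ℝ) ∈ J → J ⊆ Set.Ici 0 →
        GaussHK.IsGradientFlow V α β J p → GaussHK.energy V (p 0) ≤ E →
        ∀ t ∈ J, GaussHK.energy V (p t) ≤
          ENNReal.ofReal (Real.exp (-(GaussHK.rate lam α β r * t))) * GaussHK.energy V (p 0) +
          ENNReal.ofReal (1 - Real.exp (-(GaussHK.rate lam α β r * t))) *
            ⨅ q : GaussHK.Param d, GaussHK.energy V q := by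
  have hVi := GaussHK.GaussIntegrable.of_gauss fun q => (hint q).1
  have hg := GaussHK.GaussIntegrable.of_gauss fun q => (hint q).2.1
  have hH := fun i j => GaussHK.GaussIntegrable.of_gauss fun q => (hint q).2.2 i j
  refine ⟨fun E hE => GaussHK.exists_sublevelBound hlam (hV.differentiable two_ne_zero) hconv
    hVi hE, fun E r hr hE J p hJ h0 hJ0 hp hp0 t ht => ?_⟩
  have : Nonempty (GaussHK.Param d) := ⟨p 0⟩
  have hγ : 0 ≤ GaussHK.rate lam α β r := by
    unfold GaussHK.rate
    positivity
  have hexp : 0 ≤ 1 - Real.exp (-(GaussHK.rate lam α β r * t)) :=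
    sub_nonneg.2 (Real.exp_le_one_iff.2 (neg_nonpos.2 (mul_nonneg hγ (hJ0 ht))))
  rw [ENNReal.mul_iInf (by simp), ENNReal.add_iInf]
  refine le_iInf fun q => ?_
  simp only [GaussHK.energy_eq_ofReal_realEnergy hV.continuous hVi]
  rw [← ENNReal.ofReal_mul (Real.exp_pos _).le, ← ENNReal.ofReal_mul hexp]
  exact (ENNReal.ofReal_le_ofReal (GaussHK.realEnergy_le_of_isGradientFlow hlam hα hβ hV hconv
    hVi hg hH hr hE hJ h0 hp hp0 ht (hJ0 ht) q)).trans ENNReal.ofReal_add_le
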